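/- Let $\rho>1$ be real, $q,r\in\mathbb C$, and let $(F_\varepsilon)_{\varepsilon\in\mathbb C}$ be a family of maps $\mathbb C^2\to\mathbb C^2$ such that, for $(\varepsilon,x,y)$ near the origin of $\mathbb C^3$, $$F_\varepsilon(x,y)=\bigl(x+(x^2+\varepsilon^2)\,\alpha_\varepsilon(x,y),\; y\,(1+\rho x+\beta_\varepsilon(x,y))\bigr),$$ where $\alpha_\varepsilon(x,y)-(1+(q+1)x+ry)$ and $\beta_\varepsilon(x,y)$ both belong to the ideal generated by $x^2,xy,y^2,\varepsilon^2$ in the ring of germs at $0$ of holomorphic functions of $(\varepsilon,x,y)$ (for instance, a holomorphic family of endomorphisms of $\mathbb C^2$ of this form). Let $U$ be a neighbourhood of the origin of $\mathbb C^2$ on which $F_\varepsilon$ is injective for all $\varepsilon$ sufficiently close to $0$, and let $F_\varepsilon^{-1}:F_\varepsilon(U)\to U$ be the corresponding inverse. All logarithms are principal branches. For $\varepsilon\neq0$ set $$\tilde w_0^\iota(x,y)=-\tfrac1x-q\log(-x),\qquad \tilde w_0^o(x,y)=-\tfrac1x-q\log x,$$ $$\tilde w_\varepsilon^{\iota}(x,y)=\tfrac1{2i\varepsilon}\log\tfrac{i\varepsilon-x}{i\varepsilon+x}-\tfrac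 q2\log(\varepsilon^2+x^2)+\tfrac{\pi}{2\varepsilon},\qquad \tilde w_\varepsilon^{o}=\tilde w_\varepsilon^{\iota}-\tfrac{\pi}{\varepsilon}.$$ For $\gamma,R,s>0$ let $$\tilde C_0=\tilde C_0(\gamma,R,s)=\{(x,y)\in\mathbb C^2:\ x\ne0,\ |\operatorname{Im}x|\le-\gamma\operatorname{Re}x,\ |x|\le R,\ |y|\le s|x|\}.$$ A sequence $(\varepsilon_\nu,m_\nu)\in(\mathbb C\setminus\{0\})\times\mathbb N$ with $\varepsilon_\nu\to0$ is said to be of bounded type if $\frac{\pi}{2\varepsilon_\nu}-m_\nu$ is bounded in $\nu$. Then, for all sufficiently small $\gamma,R,s>0$ (with thresholds depending only on the family $F$ and on $U$), the following hold. 1. The limit $$\tilde\phi^\iota=\lim_{n\to\infty}\bigl(\tilde w_0^\iota\circ F_0^{n}-n\bigr)$$ exists locally uniformly on $\tilde C_0$ and satisfies $\tilde\phi^\iota\circ F_0=\tilde\phi^\iota+1$ on $\tilde C_0$. All iterates $F_0^{-n}$ are defined on $-\tilde C_0$, and the limit $$\tilde\phi^o=\lim_{n\to\infty}\bigl(\tilde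 w_0^o\circ F_0^{-n}+n\bigr)$$ exists locally uniformly on $-\tilde C_0$ and satisfies $\tilde\phi^o\circ F_0=\tilde\phi^o+1$ on $-\tilde C_0$. (On points outside these sets that occur in the functional equations, the coordinates are defined by the same pointwise limits.) 2. For every sequence $(\varepsilon_\nu,m_\nu)$ of bounded type, the incoming almost Fatou coordinates $$\tilde\phi^\iota_{\varepsilon_\nu,m_\nu}=\tilde w^\iota_{\varepsilon_\nu}\circ F_{\varepsilon_\nu}^{m_\nu}-m_\nu$$ converge to $\tilde\phi^\iota$ locally uniformly on $\tilde C_0$. 3. For every sequence $(\varepsilon_\nu,m_\nu)$ of bounded type and every compact $K\subset-\tilde C_0$, the iterates $F_{\varepsilon_\nu}^{-j}$, $0\le j\le m_\nu$, are defined on $K$ for all large $\nu$, and the outgoing almost Fatou coordinates $$\tilde\phi^o_{\varepsilon_\nu,m_\nu}=\tilde w^o_{\varepsilon_\nu}\circ F_{\varepsilon_\nu}^{-m_\nu}+m_\nu$$ converge to $\tilde\phi^o$ locally uniformly on $-\tilde C_0$. -/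

import Mathlib

open Filter Topology
open scoped Pointwise

noncomputable section

namespace TangentFamily

/-- The germ at `0 ∈ ℂ³` of `g`, a function of `(ε, x, y)`, belongs to the ideal generated by
`x²`, `xy`, `y²`, `ε²` in the ring of germs of holomorphic functions, i.e.
`g = O(x², xy, y²) + O(ε²)`. -/
def IsOTwo (g : ℂ × ℂ × ℂ → ℂ) : Prop :=
  ∃ a b c d : ℂ × ℂ × ℂ → ℂ,
    AnalyticAt ℂ a 0 ∧ AnalyticAt ℂ b 0 ∧ AnalyticAt ℂ c 0 ∧ AnalyticAt ℂ d 0 ∧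
    ∀ᶠ t : ℂ × ℂ × ℂ in 𝓝 0,
      g t = t.2.1 ^ 2 * a t + t.2.1 * t.2.2 * b t + t.2.2 ^ 2 * c t + t.1 ^ 2 * d t

/-- Near the origin of `ℂ³`, the family `F ε (x, y)` is holomorphic and has the form
`(x + (x² + ε²) α_ε(x, y), y (1 + ρ x + β_ε(x, y)))` with
`α_ε(x, y) = 1 + (q + 1) x + r y + O(x², xy, y²) + O(ε²)` and
`β_ε(x, y) = O(x², xy, y²) + O(ε²)`. -/
def HasForm (ρ : ℝ) (q r : ℂ) (F : ℂ → ℂ × ℂ → ℂ × ℂ) : Prop :=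
  ∃ α β : ℂ × ℂ × ℂ → ℂ,
    IsOTwo (fun t => α t - (1 + (q + 1) * t.2.1 + r * t.2.2)) ∧
    IsOTwo β ∧
    ∀ᶠ t : ℂ × ℂ × ℂ in 𝓝 0,
      F t.1 t.2 = (t.2.1 + (t.2.1 ^ 2 + t.1 ^ 2) * α t, t.2.2 * (1 + ρ * t.2.1 + β t))

/-- The domain `C̃₀(γ, R, s)`, with vertex `0` removed. -/
def sector (γ R s : ℝ) : Set (ℂ × ℂ) :=
  {p | p.1 ≠ 0 ∧ |p.1.im| ≤ -γ * p.1.re ∧ ‖p.1‖ ≤ R ∧ ‖p.2‖ ≤ s * ‖p.1‖}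

/-- The inverse branch of `f` with values in `U`: if `f` is injective on `U` and `p ∈ f '' U`,
this is the unique point of `U` that `f` maps to `p`. -/
def invBranch (f : ℂ × ℂ → ℂ × ℂ) (U : Set (ℂ × ℂ)) : ℂ × ℂ → ℂ × ℂ :=
  Function.invFunOn f U

/-- `w̃^ι_0 (x, y) = -1/x - q log(-x)`. -/
def wIn0 (q : ℂ) (p : ℂ × ℂ) : ℂ := -1 / p.1 - q * Complex.log (-p.1)

/-- `w̃^o_0 (x, y) = -1/x - q log x`. -/
def wOut0 (q : ℂ) (p : ℂ × ℂ) : ℂ := -1 / p.1 - q * Complex.log p.1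

/-- `u_ε (x) = (1 / (2 i ε)) log ((i ε - x) / (i ε + x)) = (1 / ε) arctan (x / ε)`. -/
def u (ε x : ℂ) : ℂ :=
  1 / (2 * Complex.I * ε) * Complex.log ((Complex.I * ε - x) / (Complex.I * ε + x))

/-- `w̃_ε (x, y) = u_ε (x) - (q / 2) log(ε² + x²)`. -/
def w (q ε : ℂ) (p : ℂ × ℂ) : ℂ := u ε p.1 - q / 2 * Complex.log (ε ^ 2 + p.1 ^ 2)

/-- The incoming normalization `w̃^ι_ε`. -/
def wIn (q ε : ℂ) (p : ℂ × ℂ) : ℂ := w q ε p + Real.pi / (2 * ε)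

/-- The outgoing normalization `w̃^o_ε`. -/
def wOut (q ε : ℂ) (p : ℂ × ℂ) : ℂ := w q ε p - Real.pi / (2 * ε)

/-- `φ̃^ι_{0,n} = w̃^ι_0 ∘ F₀ⁿ - n`. -/
def phiIn0 (q : ℂ) (F : ℂ → ℂ × ℂ → ℂ × ℂ) (n : ℕ) (p : ℂ × ℂ) : ℂ :=
  wIn0 q ((F 0)^[n] p) - n

/-- `φ̃^o_{0,n} = w̃^o_0 ∘ F₀⁻ⁿ + n`, with `F₀⁻¹` the inverse branch with values in `U`. -/
def phiOut0 (q : ℂ) (F : ℂ → ℂ × ℂ → ℂ × ℂ) (U : Set (ℂ × ℂ)) (n : ℕ) (p : ℂ × ℂ) : ℂ :=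
  wOut0 q ((invBranch (F 0) U)^[n] p) + n

/-- The incoming Fatou coordinate `φ̃^ι = lim φ̃^ι_{0,n}` of `F₀`. -/
def fatouIn (q : ℂ) (F : ℂ → ℂ × ℂ → ℂ × ℂ) (p : ℂ × ℂ) : ℂ :=
  limUnder atTop (fun n : ℕ => phiIn0 q F n p)

/-- The outgoing Fatou coordinate `φ̃^o = lim φ̃^o_{0,n}` of `F₀`. -/
def fatouOut (q : ℂ) (F : ℂ → ℂ × ℂ → ℂ × ℂ) (U : Set (ℂ × ℂ)) (p : ℂ × ℂ) : ℂ :=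
  limUnder atTop (fun n : ℕ => phiOut0 q F U n p)

/-- The incoming almost Fatou coordinate `φ̃^ι_{ε,n} = w̃^ι_ε ∘ F_εⁿ - n`. -/
def phiIn (q : ℂ) (F : ℂ → ℂ × ℂ → ℂ × ℂ) (ε : ℂ) (n : ℕ) (p : ℂ × ℂ) : ℂ :=
  wIn q ε ((F ε)^[n] p) - n

/-- The outgoing almost Fatou coordinate `φ̃^o_{ε,n} = w̃^o_ε ∘ F_ε⁻ⁿ + n`, with `F_ε⁻¹` the
inverse branch with values in `U`. -/
def phiOut (q : ℂ) (F : ℂ → ℂ × ℂ → ℂ × ℂ) (U : Set (ℂ × ℂ)) (ε : ℂ) (n : ℕ)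
    (p : ℂ × ℂ) : ℂ :=
  wOut q ε ((invBranch (F ε) U)^[n] p) + n

/-- Sequences `(ε_ν, m_ν)` of bounded type. -/
def BoundedType (ε : ℕ → ℂ) (m : ℕ → ℕ) : Prop :=
  (∀ ν, ε ν ≠ 0) ∧ Tendsto ε atTop (𝓝 0) ∧
    ∃ B : ℝ, ∀ ν, ‖(Real.pi : ℂ) / (2 * ε ν) - (m ν : ℂ)‖ ≤ B

end TangentFamily

end

/-! In the coordinate `T = u_ε(x) + π/(2ε)`, that is `x = -ε cot(εT)` (`x = -1/T` for `ε = 0`), the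
map is close to the translation `T ↦ T + 1`: its increment is `1 + qx + ry` up to second order in
`(x, y, ε)`. The term `qx` is cancelled by `(q/2) log(x² + ε²)`, whose increment is `qx` to first
order. The term `ry` is summable along orbits: up to second-order errors a step adds at most `ρ Re
x` to `log |y|` and adds `2 Re x` to `log |x² + ε²|`, so `|y| = O(|x² + ε²|^{ρ/2}) = O(|T|^{-ρ})`
with `ρ > 1`. Since `|x|, |y|, |ε|` are `O(1/|T|)` and `|T|` grows linearly, the second-order errors
are `O(j⁻²)`. Hence the `j`-th increment of the almost Fatou coordinates is dominated by a
convergent series that does not depend on `ε` (`Inv.step`, `Start.dist_phi_succ_le`).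

These estimates persist while `|εT| ≤ 9/5`, a bound lying between `π/2` and `π`: there `sin(εT)`
does not vanish and the principal logarithms recover `T` (`principal_log`). Bounded type forces `ε m
→ π/2`, so all `m` steps fit into this range and `ε` is nearly positive real
(`BoundedType.eventually`).

Convergence is then Tannery's argument: for a fixed number `N` of iterates the coordinates converge
as `ε → 0` (`Tame.tendsto_phi`), and the tails beyond `N` are uniformly small.

For the outgoing side, the inverse family conjugated by `p ↦ -p` satisfies the same quantitative
estimates with `q, r` replaced by `-q, -r` (`inverse_form`), and its incoming coordinates are the
outgoing ones up to sign (`phiOut_eq`). Only size estimates and continuity are used there, which is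
why the argument runs on `QuadForm` and `Tame`. -/

namespace TangentFamily

/-! ### Sine and cosine near the real segment [0, 9/5] -/

/-- The range goes beyond `π/2`, so Jordan's inequality is applied to `a / 2` and the angle is
doubled. -/
theorem third_le_sin {a : ℝ} (h0 : 0 ≤ a) (h1 : a ≤ 9 / 5) : a / 3 ≤ Real.sin a := by
  have hpi := Real.pi_gt_three
  have hpi' := Real.pi_lt_d2
  have hs : 2 / Real.pi * (a / 2) ≤ Real.sin (a / 2) :=
    Real.mul_le_sin (by linarith) (by linarith)
  have hc : 1 - (a / 2) ^ 2 / 2 ≤ Real.cos (a / 2) := Real.one_sub_sq_div_two_le_cos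
  have h2 : (2 / 3.15) * (a / 2) ≤ 2 / Real.pi * (a / 2) := by
    gcongr
  have hc' : (0.595 : ℝ) ≤ Real.cos (a / 2) := by nlinarith
  have : Real.sin a = 2 * Real.sin (a / 2) * Real.cos (a / 2) := by
    rw [← Real.sin_two_mul]; ring_nf
  rw [this]
  have h3 : (0.3 : ℝ) * a ≤ Real.sin (a / 2) := by
    refine le_trans ?_ (h2.trans hs); norm_num; linarith
  nlinarith

theorem sinh_cosh_bounds {b : ℝ} (hb : |b| ≤ 1 / 2) :
    |Real.sinh b| ≤ 2 * |b| ∧ 1 ≤ Real.cosh b ∧ Real.cosh b ≤ 2 := by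
  have h1 := Real.abs_exp_sub_one_le (x := b) (by linarith)
  have h2 := Real.abs_exp_sub_one_le (x := -b) (by rw [abs_neg]; linarith)
  rw [abs_neg] at h2
  rw [abs_le] at h1 h2
  refine ⟨?_, Real.one_le_cosh b, ?_⟩
  · rw [Real.sinh_eq, abs_le]; constructor <;> linarith
  · rw [Real.cosh_eq]; linarith

/-- To be used with `θ = εT`, which stays near the positive real axis and runs slightly past `π/2`.
-/
theorem sin_cos_bounds {θ : ℂ} (h0 : 0 ≤ θ.re) (h1 : θ.re ≤ 9 / 5) (h2 : |θ.im| ≤ θ.re / 40) :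
    ‖θ‖ / 4 ≤ ‖Complex.sin θ‖ ∧ ‖Complex.sin θ‖ ≤ 4 * ‖θ‖ ∧ ‖Complex.cos θ‖ ≤ 2.5 ∧
      θ.re / 3 ≤ (Complex.sin θ).re ∧ |(Complex.sin θ).im| ≤ (Complex.sin θ).re / 6 := by
  have hb : |θ.im| ≤ 0.045 := by linarith
  obtain ⟨s1, c1, c2⟩ := sinh_cosh_bounds (b := θ.im) (by linarith)
  have hs := third_le_sin h0 h1
  have hs' : |Real.sin θ.re| ≤ θ.re := Real.abs_sin_le_abs.trans (abs_of_nonneg h0).le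
  have hsr : (Complex.sin θ).re = Real.sin θ.re * Real.cosh θ.im := by
    rw [Complex.sin_eq]
    simp [← Complex.ofReal_sin, ← Complex.ofReal_cosh, ← Complex.ofReal_cos, ← Complex.ofReal_sinh]
  have hsi : (Complex.sin θ).im = Real.cos θ.re * Real.sinh θ.im := by
    rw [Complex.sin_eq]
    simp [← Complex.ofReal_sin, ← Complex.ofReal_cosh, ← Complex.ofReal_cos, ← Complex.ofReal_sinh]
  have hcr : (Complex.cos θ).re = Real.cos θ.re * Real.cosh θ.im := by
    rw [Complex.cos_eq]
    simp [← Complex.ofReal_sin, ← Complex.ofReal_cosh, ← Complex.ofReal_cos, ← Complex.ofReal_sinh]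
  have hci : (Complex.cos θ).im = - (Real.sin θ.re * Real.sinh θ.im) := by
    rw [Complex.cos_eq]
    simp [← Complex.ofReal_sin, ← Complex.ofReal_cosh, ← Complex.ofReal_cos, ← Complex.ofReal_sinh]
  have hre : θ.re / 3 ≤ (Complex.sin θ).re := by rw [hsr]; nlinarith
  have him : |(Complex.sin θ).im| ≤ 2 * |θ.im| := by
    rw [hsi, abs_mul]
    have := Real.abs_cos_le_one θ.re
    nlinarith [abs_nonneg (Real.sinh θ.im)]
  have hn : ‖θ‖ ≤ θ.re + |θ.im| := by
    have := Complex.norm_le_abs_re_add_abs_im θ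
    rwa [abs_of_nonneg h0] at this
  refine ⟨?_, ?_, ?_, hre, ?_⟩
  · have := (Complex.sin θ).re_le_norm
    linarith
  · have h3 := Complex.norm_le_abs_re_add_abs_im (Complex.sin θ)
    have h4 : |(Complex.sin θ).re| ≤ 2 * θ.re := by
      rw [hsr, abs_mul, abs_of_nonneg (show 0 ≤ Real.cosh θ.im by linarith)]
      nlinarith
    have h5 := θ.re_le_norm
    have h6 := Complex.abs_im_le_norm θ
    linarith
  · have h3 := Complex.norm_le_abs_re_add_abs_im (Complex.cos θ)
    have h4 : |(Complex.cos θ).re| ≤ 2 := by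
      rw [hcr, abs_mul, abs_of_nonneg (show 0 ≤ Real.cosh θ.im by linarith)]
      have := Real.abs_cos_le_one θ.re
      nlinarith
    have h5 : |(Complex.cos θ).im| ≤ 0.2 := by
      rw [hci, abs_neg, abs_mul]
      have := Real.abs_sin_le_one θ.re
      nlinarith [abs_nonneg (Real.sinh θ.im)]
    linarith
  · linarith

/-! ### The translation coordinate T and its admissible region -/

/-- The set of pairs `(ε, T)` for which `T` is an admissible value of the translation coordinate
`x ↦ u_ε(x) + π / (2 ε)`. -/
structure Region (ε T : ℂ) : Prop where
  re_pos : 0 < T.re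
  im_le : |T.im| ≤ T.re / 100
  eps_im : |ε.im| ≤ ε.re / 100
  mul_le : ‖ε * T‖ ≤ 9 / 5

/-- `T` is a value of the (multivalued) translation coordinate at `x`: `x = -ε cot (ε T)`, or
`x = -1 / T` if `ε = 0`. -/
def Rel (ε x T : ℂ) : Prop :=
  (ε = 0 → x * T = -1) ∧ x * Complex.sin (ε * T) = -ε * Complex.cos (ε * T)

namespace Region

variable {ε T x : ℂ}

theorem ne_zero (h : Region ε T) : T ≠ 0 := by
  rintro rfl; simpa using h.re_pos

theorem norm_pos (h : Region ε T) : 0 < ‖T‖ := norm_pos_iff.mpr h.ne_zero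

theorem eps_re_nonneg (h : Region ε T) : 0 ≤ ε.re := by
  have := h.eps_im; have := abs_nonneg ε.im; linarith

theorem eps_re_pos (h : Region ε T) (hε : ε ≠ 0) : 0 < ε.re := by
  rcases h.eps_re_nonneg.lt_or_eq with h1 | h1
  · exact h1
  · exfalso
    have h2 := h.eps_im
    rw [← h1] at h2
    have h3 : ε.im = 0 := abs_nonpos_iff.mp (by linarith)
    exact hε (Complex.ext h1.symm h3)

theorem mul_bounds (h : Region ε T) :
    0.99 * (ε.re * T.re) ≤ (ε * T).re ∧ (ε * T).re ≤ 9 / 5 ∧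
      |(ε * T).im| ≤ (ε * T).re / 40 := by
  have a1 := h.im_le
  have a2 := h.eps_im
  have hp : 0 ≤ ε.re * T.re := mul_nonneg h.eps_re_nonneg h.re_pos.le
  have h1 : |ε.im * T.im| ≤ ε.re * T.re / 10000 := by
    rw [abs_mul]
    calc |ε.im| * |T.im| ≤ (ε.re / 100) * (T.re / 100) :=
          mul_le_mul a2 a1 (abs_nonneg _) (by linarith [h.eps_re_nonneg])
      _ = _ := by ring
  have h2 : |ε.re * T.im| ≤ ε.re * T.re / 100 := by
    rw [abs_mul, abs_of_nonneg h.eps_re_nonneg]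
    calc ε.re * |T.im| ≤ ε.re * (T.re / 100) := by gcongr; exact h.eps_re_nonneg
      _ = _ := by ring
  have h3 : |ε.im * T.re| ≤ ε.re * T.re / 100 := by
    rw [abs_mul, abs_of_nonneg h.re_pos.le]
    calc |ε.im| * T.re ≤ (ε.re / 100) * T.re := mul_le_mul_of_nonneg_right a2 h.re_pos.le
      _ = _ := by ring
  have h4 : 0.99 * (ε.re * T.re) ≤ (ε * T).re := by
    rw [Complex.mul_re]; have := le_abs_self (ε.im * T.im); linarith
  refine ⟨h4, (Complex.re_le_norm _).trans h.mul_le, ?_⟩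
  rw [Complex.mul_im]
  have := abs_add_le (ε.re * T.im) (ε.im * T.re)
  linarith

theorem sin_cos (h : Region ε T) :
    ‖ε * T‖ / 4 ≤ ‖Complex.sin (ε * T)‖ ∧ ‖Complex.sin (ε * T)‖ ≤ 4 * ‖ε * T‖ ∧
      ‖Complex.cos (ε * T)‖ ≤ 2.5 ∧ (ε * T).re / 3 ≤ (Complex.sin (ε * T)).re ∧
      |(Complex.sin (ε * T)).im| ≤ (Complex.sin (ε * T)).re / 6 := by
  obtain ⟨h1, h2, h3⟩ := h.mul_bounds
  refine sin_cos_bounds ?_ h2 h3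
  have := abs_nonneg (ε * T).im; linarith

theorem sin_ne_zero (h : Region ε T) (hε : ε ≠ 0) : Complex.sin (ε * T) ≠ 0 := by
  have h1 := h.sin_cos.1
  have h2 : 0 < ‖ε * T‖ := norm_pos_iff.mpr (mul_ne_zero hε h.ne_zero)
  exact norm_pos_iff.mp (by linarith)

theorem norm_eps_le (h : Region ε T) : ‖ε‖ ≤ 2 / ‖T‖ := by
  rw [le_div_iff₀ h.norm_pos, ← norm_mul]
  linarith [h.mul_le]

theorem norm_x_le (h : Region ε T) (hr : Rel ε x T) : ‖x‖ ≤ 10 / ‖T‖ := by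
  rw [le_div_iff₀ h.norm_pos]
  by_cases hε : ε = 0
  · rw [← norm_mul, hr.1 hε]; norm_num
  · obtain ⟨h1, -, h3, -, -⟩ := h.sin_cos
    have hε' : 0 < ‖ε‖ := norm_pos_iff.mpr hε
    have e := congrArg norm hr.2
    rw [norm_mul, norm_mul, norm_neg] at e
    rw [norm_mul] at h1
    have : ‖x‖ * (‖ε‖ * ‖T‖ / 4) ≤ ‖ε‖ * 2.5 :=
      (mul_le_mul_of_nonneg_left h1 (norm_nonneg _)).trans
        (e.le.trans (mul_le_mul_of_nonneg_left h3 (norm_nonneg _)))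
    have : ‖ε‖ * (‖x‖ * ‖T‖) ≤ ‖ε‖ * 10 := by linarith
    exact le_of_mul_le_mul_left this hε'

/-- This is `1 + cot² = 1 / sin²`, written without division so that it includes `ε = 0`. -/
theorem sq_add_sq_mul (hr : Rel ε x T) :
    (x ^ 2 + ε ^ 2) * Complex.sin (ε * T) ^ 2 = ε ^ 2 := by
  have h1 := hr.2
  have h2 := Complex.sin_sq_add_cos_sq (ε * T)
  linear_combination (x * Complex.sin (ε * T) - ε * Complex.cos (ε * T)) * h1 + ε ^ 2 * h2

/-- Because `|sin(εT)|` is comparable to `|εT|`, the quantity `x² + ε² = ε² / sin²(εT)` is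
comparable to `T⁻²` uniformly in `ε`. The same need not hold for `x²`, since `x` vanishes when `εT =
π/2`. -/
theorem norm_sq_add_sq (h : Region ε T) (hr : Rel ε x T) :
    1 / (16 * ‖T‖ ^ 2) ≤ ‖x ^ 2 + ε ^ 2‖ ∧ ‖x ^ 2 + ε ^ 2‖ ≤ 16 / ‖T‖ ^ 2 := by
  have hT := h.norm_pos
  by_cases hε : ε = 0
  · have h1 : ‖x‖ * ‖T‖ = 1 := by rw [← norm_mul, hr.1 hε]; norm_num
    have h2 : ‖x‖ = 1 / ‖T‖ := by field_simp; linarith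
    subst hε
    have h3 : ‖x ^ 2 + (0 : ℂ) ^ 2‖ = 1 / ‖T‖ ^ 2 := by
      rw [show x ^ 2 + (0 : ℂ) ^ 2 = x ^ 2 by ring, norm_pow, h2]; ring
    rw [h3]
    constructor
    · apply one_div_le_one_div_of_le (by positivity); nlinarith [sq_nonneg ‖T‖]
    · gcongr; norm_num
  · obtain ⟨h1, h2, -, -, -⟩ := h.sin_cos
    have hε' : 0 < ‖ε‖ := norm_pos_iff.mpr hε
    have e := congrArg norm (sq_add_sq_mul hr)
    rw [norm_mul, norm_pow, norm_pow] at e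
    rw [norm_mul] at h1 h2
    set g := ‖x ^ 2 + ε ^ 2‖
    have hg : 0 ≤ g := norm_nonneg _
    constructor
    · rw [div_le_iff₀ (by positivity)]
      have : g * ‖Complex.sin (ε * T)‖ ^ 2 ≤ g * (4 * (‖ε‖ * ‖T‖)) ^ 2 := by gcongr
      have h5 : ‖ε‖ ^ 2 * 1 ≤ ‖ε‖ ^ 2 * (g * (16 * ‖T‖ ^ 2)) := by nlinarith
      exact le_of_mul_le_mul_left h5 (by positivity)
    · rw [le_div_iff₀ (by positivity)]
      have : g * (‖ε‖ * ‖T‖ / 4) ^ 2 ≤ g * ‖Complex.sin (ε * T)‖ ^ 2 := by gcongr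
      have h5 : ‖ε‖ ^ 2 * (g * ‖T‖ ^ 2) ≤ ‖ε‖ ^ 2 * 16 := by nlinarith
      exact le_of_mul_le_mul_left h5 (by positivity)

/-- `x² + ε²` has positive real part, so that principal logarithms of it are harmless. -/
theorem re_sq_add_sq_pos (h : Region ε T) (hr : Rel ε x T) : 0 < (x ^ 2 + ε ^ 2).re := by
  -- If `b a²` is positive real, then `arg b = -2 arg a`, which is small when `a` is near the
  -- positive axis. It is applied with `a = T` for `ε = 0` and with `a = sin(εT) / ε` otherwise.
  have key : ∀ a b : ℂ, 0 < a.re → |a.im| ≤ a.re / 4 → (b * a ^ 2).im = 0 → 0 < (b * a ^ 2).re →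
      0 < b.re := by
    intro a b h1 h2 h3 h4
    have ha : 0 < (a ^ 2).re := by
      rw [sq, Complex.mul_re]
      rw [abs_le] at h2
      nlinarith
    have hn : 0 < Complex.normSq (a ^ 2) :=
      Complex.normSq_pos.mpr (fun hc => by rw [hc] at ha; simp at ha)
    have e : b.re * Complex.normSq (a ^ 2) = (b * a ^ 2).re * (a ^ 2).re := by
      have e1 : (b * a ^ 2).im * (a ^ 2).im = 0 := by rw [h3, zero_mul]
      generalize a ^ 2 = c at *
      rw [Complex.normSq_apply]
      simp only [Complex.mul_re, Complex.mul_im] at e1 ⊢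
      linear_combination e1
    by_contra hb
    nlinarith [mul_pos h4 ha]
  by_cases hε : ε = 0
  · subst hε
    have e : (x ^ 2 + 0 ^ 2) * T ^ 2 = 1 := by linear_combination (x * T - 1) * hr.1 rfl
    apply key T _ h.re_pos (by have := h.im_le; have := h.re_pos; linarith)
    · rw [e]; simp
    · rw [e]; simp
  · have e := sq_add_sq_mul hr
    obtain ⟨-, -, -, h4, h5⟩ := h.sin_cos
    have hs := h.sin_ne_zero hε
    set S := Complex.sin (ε * T) with hS
    have hp : 0 < S.re := by
      have h6 := h.mul_bounds.1
      have := mul_pos (h.eps_re_pos hε) h.re_pos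
      linarith
    have he := h.eps_re_pos hε
    have hn : 0 < Complex.normSq ε := Complex.normSq_pos.mpr hε
    apply key (S * (starRingEnd ℂ) ε / Complex.normSq ε)
    · rw [Complex.div_ofReal_re]
      apply div_pos _ hn
      simp only [Complex.mul_re, Complex.conj_re, Complex.conj_im]
      have h7 : |S.im * ε.im| ≤ S.re / 6 * (ε.re / 100) := by
        rw [abs_mul]; have := h.eps_im; gcongr
      rw [abs_le] at h7
      nlinarith [mul_pos hp he]
    · rw [Complex.div_ofReal_re, Complex.div_ofReal_im, abs_div, abs_of_pos hn, div_right_comm]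
      gcongr
      simp only [Complex.mul_re, Complex.mul_im, Complex.conj_re, Complex.conj_im]
      have h7 : |S.im * ε.im| ≤ S.re / 6 * (ε.re / 100) := by
        rw [abs_mul]; have := h.eps_im; gcongr
      have h8 : |S.re * ε.im| ≤ S.re * (ε.re / 100) := by
        rw [abs_mul, abs_of_pos hp]; have := h.eps_im; gcongr
      have h9 : |S.im * ε.re| ≤ S.re / 6 * ε.re := by
        rw [abs_mul, abs_of_pos he]; gcongr
      rw [abs_le] at *
      constructor <;> nlinarith [mul_pos hp he]
    all_goals
      have e2 : (x ^ 2 + ε ^ 2) * (S * (starRingEnd ℂ) ε / Complex.normSq ε) ^ 2 = 1 := by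
        have h10 : (starRingEnd ℂ) ε / Complex.normSq ε = ε⁻¹ := by
          rw [Complex.inv_def]; push_cast; ring
        rw [mul_div_assoc, h10, mul_pow, ← mul_assoc, e, ← mul_pow, mul_inv_cancel₀ hε, one_pow]
      rw [e2]; simp

end Region

/-- The cotangent relation in multiplicative form, suited to a step of the dynamics, which
multiplies `x ± iε` by explicit factors. -/
theorem Rel.exp_eq {ε x T : ℂ} (hr : Rel ε x T) :
    (x + Complex.I * ε) * Complex.exp (ε * T * Complex.I) =
      (x - Complex.I * ε) * Complex.exp (-(ε * T) * Complex.I) := by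
  have h := hr.2
  rw [Complex.sin, Complex.cos] at h
  linear_combination (2 * Complex.I) * h - (x * (Complex.exp (-(ε * T) * Complex.I) -
    Complex.exp (ε * T * Complex.I))) * Complex.I_sq

theorem rel_of_exp_eq {ε x T : ℂ} (hε : ε ≠ 0)
    (h : (x + Complex.I * ε) * Complex.exp (ε * T * Complex.I) =
      (x - Complex.I * ε) * Complex.exp (-(ε * T) * Complex.I)) : Rel ε x T := by
  refine ⟨fun h0 => absurd h0 hε, ?_⟩
  rw [Complex.sin, Complex.cos]
  linear_combination (-Complex.I / 2) * h + (ε * (Complex.exp (-(ε * T) * Complex.I) +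
    Complex.exp (ε * T * Complex.I)) / 2) * Complex.I_sq

theorem Rel.add_ne_zero {ε x T : ℂ} (hr : Rel ε x T) (hε : ε ≠ 0) :
    x + Complex.I * ε ≠ 0 ∧ x - Complex.I * ε ≠ 0 := by
  have h := hr.exp_eq
  have h2 : x + Complex.I * ε = 0 ∧ x - Complex.I * ε = 0 → False := by
    rintro ⟨a, b⟩
    have : 2 * (Complex.I * ε) = 0 := by linear_combination a - b
    simp [hε] at this
  constructor <;> intro h0 <;> rw [h0, zero_mul] at h
  · exact h2 ⟨h0, (mul_eq_zero.mp h.symm).resolve_right (Complex.exp_ne_zero _)⟩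
  · exact h2 ⟨(mul_eq_zero.mp h).resolve_right (Complex.exp_ne_zero _), h0⟩

/-- The quotient equals `exp(2iεT - iπ)`, and `0 < Re(εT) ≤ 9/5 < π` puts the imaginary part of the
exponent strictly between `-π` and `π`, so the principal logarithm returns the exponent itself. -/
theorem principal_log {ε x T : ℂ} (h : Region ε T) (hr : Rel ε x T) (hε : ε ≠ 0) :
    (Complex.I * ε - x) / (Complex.I * ε + x) ∈ Complex.slitPlane ∧
      u ε x + Real.pi / (2 * ε) = T := by
  have hpi := Real.pi_gt_three
  have e1 := hr.exp_eq
  obtain ⟨n1, n2⟩ := hr.add_ne_zero hε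
  have e2 : (Complex.I * ε - x) / (Complex.I * ε + x) =
      Complex.exp (2 * (ε * T) * Complex.I - Real.pi * Complex.I) := by
    rw [div_eq_iff (by rwa [add_comm]), Complex.exp_sub, Complex.exp_pi_mul_I]
    have e3 : Complex.exp (2 * (ε * T) * Complex.I) =
        Complex.exp (ε * T * Complex.I) * Complex.exp (ε * T * Complex.I) := by
      rw [← Complex.exp_add]; ring_nf
    have e4 : Complex.exp (ε * T * Complex.I) * Complex.exp (-(ε * T) * Complex.I) = 1 := by
      rw [← Complex.exp_add]; ring_nf; simp
    rw [e3]
    linear_combination (-Complex.exp (ε * T * Complex.I)) * (-e1) +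
      (x - Complex.I * ε) * e4
  have him : (2 * (ε * T) * Complex.I - Real.pi * Complex.I).im = 2 * (ε * T).re - Real.pi := by
    simp
  have hb := h.mul_bounds
  have hpos := mul_pos (h.eps_re_pos hε) h.re_pos
  have hlog : Complex.log ((Complex.I * ε - x) / (Complex.I * ε + x)) =
      2 * (ε * T) * Complex.I - Real.pi * Complex.I := by
    rw [e2, Complex.log_exp] <;> rw [him] <;> linarith
  constructor
  · rw [Complex.mem_slitPlane_iff_arg]
    refine ⟨?_, by rw [e2]; exact Complex.exp_ne_zero _⟩
    rw [← Complex.log_im, hlog, him]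
    intro; linarith
  · rw [u, hlog]
    field_simp
    ring

/-- The normalized coordinate `w̃^ι_ε`, including `ε = 0`. -/
noncomputable def wI (q ε : ℂ) (p : ℂ × ℂ) : ℂ := if ε = 0 then wIn0 q p else wIn q ε p

theorem log_sq_of_re_neg {x : ℂ} (hx : x.re < 0) :
    Complex.log (x ^ 2) = 2 * Complex.log (-x) := by
  have hx0 : -x ≠ 0 := by
    intro h; have := congrArg Complex.re h; simp at this; linarith
  have harg := Complex.abs_arg_lt_pi_div_two_iff (z := -x) |>.mpr (Or.inl (by simpa using hx))
  rw [abs_lt] at harg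
  rw [show x ^ 2 = (-x) * (-x) by ring, Complex.log_mul hx0 hx0 ⟨by linarith, by linarith⟩]
  ring

theorem Rel.zero_eq {x T : ℂ} (hr : Rel 0 x T) : T ≠ 0 ∧ x ≠ 0 ∧ T = -1 / x ∧ x = -1 / T := by
  have h := hr.1 rfl
  have hT : T ≠ 0 := by rintro rfl; norm_num at h
  have hx : x ≠ 0 := by rintro rfl; norm_num at h
  refine ⟨hT, hx, ?_, ?_⟩
  · field_simp; linear_combination h
  · field_simp; linear_combination h

theorem Region.re_neg_of_zero {x T : ℂ} (h : Region 0 T) (hr : Rel 0 x T) :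
    x.re < 0 ∧ |x.im| ≤ -x.re / 100 := by
  obtain ⟨hT, hx, e1, e2⟩ := hr.zero_eq
  have hn : 0 < Complex.normSq T := Complex.normSq_pos.mpr hT
  have hre : x.re = -(T.re / Complex.normSq T) := by
    rw [e2, neg_div, one_div, Complex.neg_re, Complex.inv_re]
  have him : x.im = T.im / Complex.normSq T := by
    rw [e2, neg_div, one_div, Complex.neg_im, Complex.inv_im]; ring
  constructor
  · rw [hre]; have := div_pos h.re_pos hn; linarith
  · rw [hre, him, abs_div, abs_of_pos hn, neg_neg, div_right_comm]
    have := h.im_le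
    gcongr

/-- One formula for all `ε`: for `ε = 0` the term `q log(-x)` equals `(q/2) log(x²)` because `Re x <
0`. -/
theorem wI_eq {ε T : ℂ} {p : ℂ × ℂ} (q : ℂ) (h : Region ε T) (hr : Rel ε p.1 T) :
    wI q ε p = T - q / 2 * Complex.log (p.1 ^ 2 + ε ^ 2) := by
  by_cases hε : ε = 0
  · subst hε
    obtain ⟨hT, hx, e1, e2⟩ := hr.zero_eq
    rw [wI, if_pos rfl, wIn0, ← e1]
    rw [show p.1 ^ 2 + (0 : ℂ) ^ 2 = p.1 ^ 2 by ring, log_sq_of_re_neg (h.re_neg_of_zero hr).1]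
    ring
  · rw [wI, if_neg hε, wIn, w, ← (principal_log h hr hε).2, add_comm (ε ^ 2)]
    ring

/-! ### One step of the dynamics in the coordinates T and log(x² + ε²) -/

/-- The increment of the translation coordinate when `x` is replaced by `x + (x² + ε²) a`. -/
noncomputable def stepT (ε x a : ℂ) : ℂ :=
  if ε = 0 then a / (1 + x * a)
  else (Complex.log (1 + (x + Complex.I * ε) * a) - Complex.log (1 + (x - Complex.I * ε) * a)) /
    (2 * Complex.I * ε)

/-- The increment of `log (x² + ε²)` when `x` is replaced by `x + (x² + ε²) a`. -/
noncomputable def stepL (ε x a : ℂ) : ℂ :=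
  Complex.log (1 + (x + Complex.I * ε) * a) + Complex.log (1 + (x - Complex.I * ε) * a)

section Step

variable {ε x a : ℂ}

theorem norm_step_le (ha : ‖a‖ ≤ 2) (hs : ‖x‖ + ‖ε‖ ≤ 1 / 16) :
    ‖(x + Complex.I * ε) * a‖ ≤ 1 / 8 ∧ ‖(x - Complex.I * ε) * a‖ ≤ 1 / 8 := by
  have e : ‖Complex.I * ε‖ = ‖ε‖ := by simp
  have h1 := norm_add_le x (Complex.I * ε)
  have h2 := norm_sub_le x (Complex.I * ε)
  rw [e] at h1 h2
  constructor <;> rw [norm_mul]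
  · calc _ ≤ (1 / 16) * (2 : ℝ) := by gcongr; linarith
      _ = _ := by norm_num
  · calc _ ≤ (1 / 16) * (2 : ℝ) := by gcongr; linarith
      _ = _ := by norm_num

theorem one_add_ne_zero_of_norm_le {z : ℂ} (hz : ‖z‖ ≤ 1 / 8) : 1 + z ≠ 0 := by
  intro h
  have : z = -1 := by linear_combination h
  rw [this] at hz; norm_num at hz

theorem one_add_mem_slitPlane_of_norm_le {z : ℂ} (hz : ‖z‖ ≤ 1 / 8) :
    1 + z ∈ Complex.slitPlane := by
  left
  have := (abs_le.mp ((Complex.abs_re_le_norm z).trans hz)).1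
  rw [Complex.add_re, Complex.one_re]; linarith

/-- Since `x² + ε² = (x + iε)(x - iε)`, the new point satisfies `x' ± iε = (x ± iε)(1 + (x ∓ iε)
a)`; the exponential relation then absorbs the two factors into a shift of `T`. -/
theorem rel_step {T : ℂ} (hr : Rel ε x T) (ha : ‖a‖ ≤ 2) (hs : ‖x‖ + ‖ε‖ ≤ 1 / 16) :
    Rel ε (x + (x ^ 2 + ε ^ 2) * a) (T + stepT ε x a) := by
  obtain ⟨b1, b2⟩ := norm_step_le ha hs
  have n1 := one_add_ne_zero_of_norm_le b1
  have n2 := one_add_ne_zero_of_norm_le b2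
  by_cases hε : ε = 0
  · subst hε
    obtain ⟨hT, hx, e1, e2⟩ := hr.zero_eq
    have n : 1 + x * a ≠ 0 := by simpa using n1
    constructor
    · intro _
      rw [stepT, if_pos rfl, e1]
      field_simp
      ring
    · simp
  · apply rel_of_exp_eq hε
    rw [stepT, if_neg hε]
    set A := Complex.log (1 + (x + Complex.I * ε) * a) with hA
    set B := Complex.log (1 + (x - Complex.I * ε) * a) with hB
    -- The shift enters the relation through half of `A - B`, so each factor is written as the
    -- square of an exponential.
    have eA : Complex.exp (A / 2) * Complex.exp (A / 2) = 1 + (x + Complex.I * ε) * a := by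
      rw [← Complex.exp_add, add_halves, hA, Complex.exp_log n1]
    have eB : Complex.exp (B / 2) * Complex.exp (B / 2) = 1 + (x - Complex.I * ε) * a := by
      rw [← Complex.exp_add, add_halves, hB, Complex.exp_log n2]
    have i1 : ε * (T + (A - B) / (2 * Complex.I * ε)) * Complex.I =
        ε * T * Complex.I + A / 2 - B / 2 := by
      field_simp; ring
    have i2 : -(ε * (T + (A - B) / (2 * Complex.I * ε))) * Complex.I =
        -(ε * T) * Complex.I + B / 2 - A / 2 := by
      field_simp; ring
    rw [i1, i2, Complex.exp_sub, Complex.exp_sub, Complex.exp_add, Complex.exp_add]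
    have h := hr.exp_eq
    have x1 : x + (x ^ 2 + ε ^ 2) * a + Complex.I * ε =
        (x + Complex.I * ε) * (Complex.exp (B / 2) * Complex.exp (B / 2)) := by
      rw [eB]; linear_combination (a * ε ^ 2) * Complex.I_sq
    have x2 : x + (x ^ 2 + ε ^ 2) * a - Complex.I * ε =
        (x - Complex.I * ε) * (Complex.exp (A / 2) * Complex.exp (A / 2)) := by
      rw [eA]; linear_combination (a * ε ^ 2) * Complex.I_sq
    rw [x1, x2]
    have hA0 := Complex.exp_ne_zero (A / 2)
    have hB0 := Complex.exp_ne_zero (B / 2)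
    generalize Complex.exp (ε * T * Complex.I) = e at *
    generalize Complex.exp (-(ε * T) * Complex.I) = e' at *
    field_simp
    linear_combination h

theorem norm_log_one_add_sub_le {z : ℂ} (hz : ‖z‖ ≤ 1 / 8) :
    ‖Complex.log (1 + z) - z‖ ≤ ‖z‖ ^ 2 := by
  have h := Complex.norm_log_one_add_sub_self_le (z := z) (by linarith)
  refine h.trans ?_
  have : (1 - ‖z‖)⁻¹ ≤ 2 := by
    rw [inv_le_comm₀] <;> linarith
  have h2 := mul_le_mul_of_nonneg_left this (sq_nonneg ‖z‖)
  linarith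

theorem norm_stepL_sub_le (ha : ‖a‖ ≤ 2) (hs : ‖x‖ + ‖ε‖ ≤ 1 / 16) :
    ‖stepL ε x a - 2 * (x * a)‖ ≤ 16 * (‖x‖ ^ 2 + ‖ε‖ ^ 2) := by
  obtain ⟨b1, b2⟩ := norm_step_le ha hs
  have e : stepL ε x a - 2 * (x * a) =
      (Complex.log (1 + (x + Complex.I * ε) * a) - (x + Complex.I * ε) * a) +
      (Complex.log (1 + (x - Complex.I * ε) * a) - (x - Complex.I * ε) * a) := by
    rw [stepL]; ring
  rw [e]
  refine (norm_add_le _ _).trans ?_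
  have h1 := norm_log_one_add_sub_le b1
  have h2 := norm_log_one_add_sub_le b2
  have e : ‖Complex.I * ε‖ = ‖ε‖ := by simp
  have h3 := norm_add_le x (Complex.I * ε)
  have h4 := norm_sub_le x (Complex.I * ε)
  rw [e] at h3 h4
  have key : ∀ s : ℂ, ‖s‖ ≤ ‖x‖ + ‖ε‖ → ‖s * a‖ ^ 2 ≤ 8 * (‖x‖ ^ 2 + ‖ε‖ ^ 2) := by
    intro s hs
    rw [norm_mul, mul_pow]
    calc ‖s‖ ^ 2 * ‖a‖ ^ 2 ≤ (‖x‖ + ‖ε‖) ^ 2 * 2 ^ 2 := by gcongr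
      _ ≤ _ := by nlinarith [sq_nonneg (‖x‖ - ‖ε‖)]
  have := key _ h3
  have := key _ h4
  linarith

/-- The quadratic Taylor polynomial of `log(1 + as)` contributes exactly `a - a²x` to the difference
quotient between `x ± iε`. The remainder has derivative `a³s² / (1 + as)`, so the mean value
inequality gains a factor `2|ε|` and the division by `2iε` costs nothing. -/
theorem norm_stepT_sub_le (ha : ‖a‖ ≤ 2) (hs : ‖x‖ + ‖ε‖ ≤ 1 / 16) :
    ‖stepT ε x a - (a - a ^ 2 * x)‖ ≤ 20 * (‖x‖ ^ 2 + ‖ε‖ ^ 2) := by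
  obtain ⟨b1, b2⟩ := norm_step_le ha hs
  have hfrac : ∀ s : ℂ, ‖s‖ ≤ ‖x‖ + ‖ε‖ →
      1 + a * s ≠ 0 ∧ ‖a ^ 3 * s ^ 2 / (1 + a * s)‖ ≤ 10 * (‖x‖ + ‖ε‖) ^ 2 := by
    intro s hs'
    have h8 : ‖a * s‖ ≤ 1 / 8 := by
      rw [norm_mul]
      calc _ ≤ 2 * (1 / 16 : ℝ) := by gcongr; linarith
        _ = _ := by norm_num
    have hn := one_add_ne_zero_of_norm_le h8
    refine ⟨hn, ?_⟩
    have hl : 7 / 8 ≤ ‖1 + a * s‖ := by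
      have := norm_sub_norm_le (1 : ℂ) (-(a * s))
      rw [sub_neg_eq_add, norm_neg, norm_one] at this
      linarith
    rw [norm_div, norm_mul, norm_pow, norm_pow, div_le_iff₀ (by linarith)]
    calc ‖a‖ ^ 3 * ‖s‖ ^ 2 ≤ 2 ^ 3 * (‖x‖ + ‖ε‖) ^ 2 := by gcongr
      _ ≤ 10 * (‖x‖ + ‖ε‖) ^ 2 * (7 / 8) := by nlinarith [sq_nonneg (‖x‖ + ‖ε‖)]
      _ ≤ _ := by gcongr
  have h20 : 10 * (‖x‖ + ‖ε‖) ^ 2 ≤ 20 * (‖x‖ ^ 2 + ‖ε‖ ^ 2) := by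
    nlinarith [sq_nonneg (‖x‖ - ‖ε‖)]
  refine le_trans ?_ h20
  by_cases hε : ε = 0
  · rw [stepT, if_pos hε]
    obtain ⟨n1, h1⟩ := hfrac x (by linarith [norm_nonneg ε])
    have e : a / (1 + x * a) - (a - a ^ 2 * x) = a ^ 3 * x ^ 2 / (1 + a * x) := by
      rw [mul_comm x a, eq_div_iff n1, sub_mul, div_mul_cancel₀ _ n1]; ring
    rw [e]; exact h1
  · rw [stepT, if_neg hε]
    set f : ℂ → ℂ := fun s => Complex.log (1 + a * s) - a * s + a ^ 2 * s ^ 2 / 2 with hf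
    have hd : ∀ s ∈ Metric.closedBall (0 : ℂ) (‖x‖ + ‖ε‖),
        HasDerivWithinAt f (a ^ 3 * s ^ 2 / (1 + a * s))
          (Metric.closedBall (0 : ℂ) (‖x‖ + ‖ε‖)) s := by
      intro s hs'
      rw [mem_closedBall_zero_iff] at hs'
      have h8 : ‖a * s‖ ≤ 1 / 8 := by
        rw [norm_mul]
        calc _ ≤ 2 * (1 / 16 : ℝ) := by gcongr; linarith
          _ = _ := by norm_num
      have hn := one_add_ne_zero_of_norm_le h8
      have d1 : HasDerivAt (fun s : ℂ => a * s) a s := by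
        simpa using (hasDerivAt_id s).const_mul a
      have d2 := (d1.const_add 1).clog (one_add_mem_slitPlane_of_norm_le h8)
      have d3 := ((hasDerivAt_pow 2 s).const_mul (a ^ 2)).div_const 2
      have d4 := (d2.sub d1).add d3
      refine (d4.congr_deriv ?_).hasDerivWithinAt
      simp only [Nat.cast_ofNat, Nat.add_one_sub_one, pow_one]
      field_simp
      ring
    have e' : ‖Complex.I * ε‖ = ‖ε‖ := by simp
    have m1 : x + Complex.I * ε ∈ Metric.closedBall (0 : ℂ) (‖x‖ + ‖ε‖) := by
      rw [mem_closedBall_zero_iff]; exact (norm_add_le _ _).trans_eq (by rw [e'])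
    have m2 : x - Complex.I * ε ∈ Metric.closedBall (0 : ℂ) (‖x‖ + ‖ε‖) := by
      rw [mem_closedBall_zero_iff]; exact (norm_sub_le _ _).trans_eq (by rw [e'])
    have hm := (convex_closedBall (0 : ℂ) (‖x‖ + ‖ε‖)).norm_image_sub_le_of_norm_hasDerivWithin_le
      hd (fun s hs' => (hfrac s (mem_closedBall_zero_iff.mp hs')).2) m2 m1
    have hI : (2 * Complex.I * ε) ≠ 0 := by simp [hε]
    have e2 : (Complex.log (1 + (x + Complex.I * ε) * a) -
        Complex.log (1 + (x - Complex.I * ε) * a)) / (2 * Complex.I * ε) - (a - a ^ 2 * x) =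
        (f (x + Complex.I * ε) - f (x - Complex.I * ε)) / (2 * Complex.I * ε) := by
      rw [eq_div_iff hI, sub_mul, div_mul_cancel₀ _ hI, hf]
      simp only [mul_comm a]
      ring
    rw [e2, norm_div]
    have e3 : x + Complex.I * ε - (x - Complex.I * ε) = 2 * Complex.I * ε := by ring
    rw [e3] at hm
    rw [div_le_iff₀ (norm_pos_iff.mpr hI)]
    exact hm

theorem exp_stepL (ha : ‖a‖ ≤ 2) (hs : ‖x‖ + ‖ε‖ ≤ 1 / 16) :
    (x + (x ^ 2 + ε ^ 2) * a) ^ 2 + ε ^ 2 = (x ^ 2 + ε ^ 2) * Complex.exp (stepL ε x a) := by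
  obtain ⟨b1, b2⟩ := norm_step_le ha hs
  rw [stepL, Complex.exp_add, Complex.exp_log (one_add_ne_zero_of_norm_le b1),
    Complex.exp_log (one_add_ne_zero_of_norm_le b2)]
  linear_combination ((x ^ 2 + ε ^ 2) * a ^ 2 * ε ^ 2) * Complex.I_sq

/-- No branch jump occurs: the argument of `x² + ε²` is below `π/2` in modulus and the imaginary
part of `stepL` is at most `1/2`. -/
theorem log_step (ha : ‖a‖ ≤ 2) (hs : ‖x‖ + ‖ε‖ ≤ 1 / 16) (hre : 0 < (x ^ 2 + ε ^ 2).re) :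
    Complex.log ((x + (x ^ 2 + ε ^ 2) * a) ^ 2 + ε ^ 2) =
      Complex.log (x ^ 2 + ε ^ 2) + stepL ε x a := by
  obtain ⟨b1, b2⟩ := norm_step_le ha hs
  have hpi := Real.pi_gt_three
  have hne : x ^ 2 + ε ^ 2 ≠ 0 := by intro h; rw [h] at hre; simp at hre
  have key : ∀ z : ℂ, ‖z‖ ≤ 1 / 8 → |(Complex.log (1 + z)).im| ≤ 1 / 4 := by
    intro z hz
    refine (Complex.abs_im_le_norm _).trans ?_
    have := Complex.norm_log_one_add_half_le_self (z := z) (by linarith)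
    linarith
  have k1 := abs_le.mp (key _ b1)
  have k2 := abs_le.mp (key _ b2)
  have k3 := abs_lt.mp (Complex.abs_arg_lt_pi_div_two_iff.mpr (Or.inl hre))
  have him : (Complex.log (x ^ 2 + ε ^ 2) + stepL ε x a).im = Complex.arg (x ^ 2 + ε ^ 2) +
      ((Complex.log (1 + (x + Complex.I * ε) * a)).im +
        (Complex.log (1 + (x - Complex.I * ε) * a)).im) := by
    rw [stepL, Complex.add_im, Complex.log_im, Complex.add_im]
  rw [exp_stepL ha hs]
  nth_rewrite 1 [← Complex.exp_log hne]
  rw [← Complex.exp_add, Complex.log_exp] <;> rw [him] <;> linarith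

end Step

/-! ### The initial value of the translation coordinate -/

/-- With `v = iε/x` the quotient in `u` is `-(1 - v)/(1 + v)`. The sign of `Im v` selects `-iπ` as
the logarithm of `-1`, and this is cancelled by the added `π/(2ε)`. What remains, `(log(1 - v) -
log(1 + v)) / (2iε)`, has leading term `-2v/(2iε) = -1/x`. -/
theorem exists_initial {ε x : ℂ} (hε : ε ≠ 0) (hx : x ≠ 0) (hsmall : ‖ε‖ ≤ ‖x‖ / 8)
    (hre : (ε / x).re < 0) :
    Rel ε x (u ε x + Real.pi / (2 * ε)) ∧ ‖u ε x + Real.pi / (2 * ε) - -1 / x‖ ≤ ‖ε‖ / ‖x‖ ^ 2 := by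
  have hpi := Real.pi_gt_three
  have hxn : 0 < ‖x‖ := norm_pos_iff.mpr hx
  set v := Complex.I * ε / x with hv
  have hvn : ‖v‖ = ‖ε‖ / ‖x‖ := by rw [hv, norm_div, norm_mul, Complex.norm_I, one_mul]
  have hv8 : ‖v‖ ≤ 1 / 8 := by rw [hvn, div_le_iff₀ hxn]; linarith
  have hv8' : ‖-v‖ ≤ 1 / 8 := by rwa [norm_neg]
  have hvim : v.im < 0 := by
    rw [hv, mul_div_assoc, Complex.I_mul_im]; exact hre
  have n1 := one_add_ne_zero_of_norm_le hv8
  have n2 := one_add_ne_zero_of_norm_le hv8'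
  have key : ∀ z : ℂ, ‖z‖ ≤ 1 / 8 → |(Complex.log (1 + z)).im| ≤ 1 / 4 := by
    intro z hz
    refine (Complex.abs_im_le_norm _).trans ?_
    have := Complex.norm_log_one_add_half_le_self (z := z) (by linarith)
    linarith
  have a1 : (Complex.log (1 + v)).im < 0 := by
    rw [Complex.log_im, Complex.arg_neg_iff]; simpa using hvim
  have a2 : 0 ≤ (Complex.log (1 + -v)).im := by
    rw [Complex.log_im, Complex.arg_nonneg_iff]; simpa using hvim.le
  have k1 := abs_le.mp (key _ hv8)
  have k2 := abs_le.mp (key _ hv8')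
  have hlog : Complex.log ((Complex.I * ε - x) / (Complex.I * ε + x)) =
      Complex.log (1 + -v) - Complex.log (1 + v) - Real.pi * Complex.I := by
    have e : (Complex.I * ε - x) / (Complex.I * ε + x) =
        Complex.exp (Complex.log (1 + -v) - Complex.log (1 + v) - Real.pi * Complex.I) := by
      rw [Complex.exp_sub, Complex.exp_sub, Complex.exp_log n1, Complex.exp_log n2,
        Complex.exp_pi_mul_I]
      have e1 : Complex.I * ε + x = x * (1 + v) := by rw [hv]; field_simp; ring
      have e2 : Complex.I * ε - x = -(x * (1 + -v)) := by rw [hv]; field_simp; ring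
      rw [e1, e2]
      generalize 1 + -v = s at *
      generalize 1 + v = t at *
      field_simp
    have him : (Complex.log (1 + -v) - Complex.log (1 + v) - Real.pi * Complex.I).im =
        (Complex.log (1 + -v)).im - (Complex.log (1 + v)).im - Real.pi := by simp
    rw [e, Complex.log_exp] <;> rw [him] <;> linarith
  have hT : u ε x + Real.pi / (2 * ε) =
      (Complex.log (1 + -v) - Complex.log (1 + v)) / (2 * Complex.I * ε) := by
    rw [u, hlog]; field_simp; ring
  rw [hT]
  constructor
  · apply rel_of_exp_eq hε
    set A := Complex.log (1 + -v) with hA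
    set B := Complex.log (1 + v) with hB
    have eA : Complex.exp (A / 2) * Complex.exp (A / 2) = 1 + -v := by
      rw [← Complex.exp_add, add_halves, hA, Complex.exp_log n2]
    have eB : Complex.exp (B / 2) * Complex.exp (B / 2) = 1 + v := by
      rw [← Complex.exp_add, add_halves, hB, Complex.exp_log n1]
    have i1 : ε * ((A - B) / (2 * Complex.I * ε)) * Complex.I = A / 2 - B / 2 := by
      field_simp
    have i2 : -(ε * ((A - B) / (2 * Complex.I * ε))) * Complex.I = B / 2 - A / 2 := by
      field_simp; ring
    have hxv : x * v = Complex.I * ε := by rw [hv]; field_simp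
    have x1 : x + Complex.I * ε = x * (Complex.exp (B / 2) * Complex.exp (B / 2)) := by
      rw [eB, ← hxv]; ring
    have x2 : x - Complex.I * ε = x * (Complex.exp (A / 2) * Complex.exp (A / 2)) := by
      rw [eA, ← hxv]; ring
    rw [i1, i2, x1, x2, Complex.exp_sub, Complex.exp_sub]
    have := Complex.exp_ne_zero (A / 2)
    have := Complex.exp_ne_zero (B / 2)
    field_simp
  · have hI : (2 * Complex.I * ε) ≠ 0 := by simp [hε]
    have e : (Complex.log (1 + -v) - Complex.log (1 + v)) / (2 * Complex.I * ε) - -1 / x =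
        ((Complex.log (1 + -v) - -v) - (Complex.log (1 + v) - v)) / (2 * Complex.I * ε) := by
      rw [eq_div_iff hI, sub_mul, div_mul_cancel₀ _ hI, hv]; field_simp; ring
    have hIn : ‖2 * Complex.I * ε‖ = 2 * ‖ε‖ := by simp
    have hεn : 0 < ‖ε‖ := norm_pos_iff.mpr hε
    rw [e, norm_div, hIn, div_le_iff₀ (by positivity)]
    have h1 := norm_log_one_add_sub_le hv8
    have h2 := norm_log_one_add_sub_le hv8'
    refine (norm_sub_le _ _).trans ?_
    rw [norm_neg] at h2
    calc _ ≤ ‖v‖ ^ 2 + ‖v‖ ^ 2 := add_le_add h2 h1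
      _ = _ := by rw [hvn]; field_simp; ring

/-! ### Quantitative form of the family and one-step bounds -/

/-- Quantitative form of `HasForm`: near the origin the remainders are bounded by a multiple of
`|x|² + |y|² + |ε|²`. -/
structure QuadForm (ρ : ℝ) (q r : ℂ) (F : ℂ → ℂ × ℂ → ℂ × ℂ) (C δ : ℝ) : Prop where
  nonneg : 0 ≤ C
  pos : 0 < δ
  form : ∀ ε x y : ℂ, ‖ε‖ < δ → ‖x‖ < δ → ‖y‖ < δ → ∃ a b : ℂ,
    F ε (x, y) = (x + (x ^ 2 + ε ^ 2) * a, y * (1 + ρ * x + b)) ∧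
      ‖a - (1 + (q + 1) * x + r * y)‖ ≤ C * (‖x‖ ^ 2 + ‖y‖ ^ 2 + ‖ε‖ ^ 2) ∧
      ‖b‖ ≤ C * (‖x‖ ^ 2 + ‖y‖ ^ 2 + ‖ε‖ ^ 2)

/-- Effect of one step of the dynamics on the translation coordinate, on `log (x² + ε²)` and on
`|y|`. -/
structure StepBound (ρ : ℝ) (q r : ℂ) (F : ℂ → ℂ × ℂ → ℂ × ℂ) (C δ : ℝ) : Prop where
  nonneg : 0 ≤ C
  pos : 0 < δ
  step : ∀ (ε : ℂ) (p : ℂ × ℂ), ‖ε‖ < δ → ‖p.1‖ < δ → ‖p.2‖ < δ → ∃ a : ℂ,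
    (F ε p).1 = p.1 + (p.1 ^ 2 + ε ^ 2) * a ∧ ‖a‖ ≤ 2 ∧ ‖p.1‖ + ‖ε‖ ≤ 1 / 16 ∧
      ‖stepT ε p.1 a - 1‖ ≤ 1 / 200 ∧
      ‖stepT ε p.1 a - (1 + q * p.1 + r * p.2)‖ ≤ C * (‖p.1‖ ^ 2 + ‖p.2‖ ^ 2 + ‖ε‖ ^ 2) ∧
      ‖stepL ε p.1 a - 2 * p.1‖ ≤ C * (‖p.1‖ ^ 2 + ‖p.2‖ ^ 2 + ‖ε‖ ^ 2) ∧
      ‖(F ε p).2‖ ≤ ‖p.2‖ * Real.exp (ρ * p.1.re + C * (‖p.1‖ ^ 2 + ‖p.2‖ ^ 2 + ‖ε‖ ^ 2))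

variable {ρ : ℝ} {q r : ℂ} {F : ℂ → ℂ × ℂ → ℂ × ℂ} {C δ : ℝ}

theorem StepBound.mono (h : StepBound ρ q r F C δ) {δ' : ℝ} (h0 : 0 < δ') (h1 : δ' ≤ δ) :
    StepBound ρ q r F C δ' :=
  ⟨h.nonneg, h0, fun ε p a b c => h.step ε p (a.trans_le h1) (b.trans_le h1) (c.trans_le h1)⟩

/-- From `1 + t ≤ eᵗ` with `t = 2 Re z + |z|²`. Keeping `Re z` rather than `|z|` is what later
yields the exact exponent `ρ` in the decay of `y`. -/
theorem norm_one_add_le_exp (z : ℂ) : ‖1 + z‖ ≤ Real.exp (z.re + ‖z‖ ^ 2 / 2) := by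
  have h : ‖1 + z‖ ^ 2 ≤ Real.exp (z.re + ‖z‖ ^ 2 / 2) ^ 2 := by
    rw [← Real.exp_nat_mul, Complex.sq_norm, Complex.sq_norm]
    have := Real.add_one_le_exp (((2 : ℕ) : ℝ) * (z.re + Complex.normSq z / 2))
    refine le_trans (le_of_eq ?_) this
    simp only [Complex.normSq_apply, Complex.add_re, Complex.add_im, Complex.one_re, Complex.one_im]
    push_cast
    ring
  exact le_of_sq_le_sq h (Real.exp_nonneg _)

-- Since `a = 1 + (q + 1)x + ry` to first order, `a - a²x` becomes `1 + qx + ry`: passing to the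
-- translation coordinate lowers `q + 1` to `q`.
set_option maxHeartbeats 400000 in
theorem QuadForm.exists_stepBound (h : QuadForm ρ q r F C δ) :
    ∃ C' δ', StepBound ρ q r F C' δ' := by
  have hC := h.nonneg
  -- `K` controls `|a - 1| ≤ K s` with `s = |x| + |y| + |ε|`. The constant `K3` makes the deviation
  -- of `stepT` from 1 at most `s K3 / 200`, and `1 / (3 K3)` bounds each of the three summands of
  -- `s`.
  set K := ‖q + 1‖ + ‖r‖ + C with hK
  have hK0 : 0 ≤ K := by positivity
  set C' := 20 + C + 9 * K + 3 * (|ρ| + C) ^ 2 with hC'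
  set K3 := 200 * (20 + C + 9 * K + ‖q‖ + ‖r‖) with hK3
  have hK3' : 4000 ≤ K3 := by
    have := norm_nonneg q; have := norm_nonneg r; rw [hK3]; linarith
  refine ⟨C', min δ (1 / (3 * K3)), by positivity, lt_min h.pos (by positivity), ?_⟩
  rintro ε ⟨x, y⟩ hε hx hy
  simp only at hx hy
  obtain ⟨a, b, e, ha, hb⟩ := h.form ε x y (hε.trans_le (min_le_left _ _))
    (hx.trans_le (min_le_left _ _)) (hy.trans_le (min_le_left _ _))
  have hm := min_le_right δ (1 / (3 * K3))
  set Q := ‖x‖ ^ 2 + ‖y‖ ^ 2 + ‖ε‖ ^ 2 with hQ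
  have hQ0 : 0 ≤ Q := by positivity
  set s := ‖x‖ + ‖y‖ + ‖ε‖ with hs
  have hx0 := norm_nonneg x
  have hy0 := norm_nonneg y
  have hε0 := norm_nonneg ε
  have hsK : s * K3 ≤ 1 := by
    have h1 : s ≤ 3 * (1 / (3 * K3)) := by linarith
    have h2 : 3 * (1 / (3 * K3)) * K3 = 1 := by field_simp
    calc s * K3 ≤ 3 * (1 / (3 * K3)) * K3 := by gcongr
      _ = 1 := h2
  have hs0 : 0 ≤ s := by positivity
  have hs1 : s ≤ 1 / 4000 := by
    have : s * 4000 ≤ s * K3 := by gcongr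
    linarith
  have hQs : Q ≤ s ^ 2 := by
    rw [hQ, hs]; nlinarith [mul_nonneg hx0 hy0, mul_nonneg hx0 hε0, mul_nonneg hy0 hε0]
  have hsQ : s ^ 2 ≤ 3 * Q := by
    rw [hQ, hs]; nlinarith [sq_nonneg (‖x‖ - ‖y‖), sq_nonneg (‖x‖ - ‖ε‖), sq_nonneg (‖y‖ - ‖ε‖)]
  have hss : s ^ 2 ≤ s := by nlinarith
  have hxs : ‖x‖ ≤ s := by linarith
  have hys : ‖y‖ ≤ s := by linarith
  have ha1 : ‖a - 1‖ ≤ K * s := by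
    have e1 : a - 1 = (a - (1 + (q + 1) * x + r * y)) + (q + 1) * x + r * y := by ring
    rw [e1]
    refine (norm_add₃_le).trans ?_
    rw [norm_mul, norm_mul]
    calc _ ≤ C * s + ‖q + 1‖ * s + ‖r‖ * s := by
          gcongr; exact ha.trans (by gcongr; linarith)
      _ = K * s := by rw [hK]; ring
  have hKs : K * s ≤ 1 := by
    have : K * s ≤ K3 * s := by
      gcongr; rw [hK3]; linarith [norm_nonneg q, norm_nonneg r]
    linarith
  have ha2 : ‖a‖ ≤ 2 := by
    have := norm_add_le (a - 1) 1
    rw [sub_add_cancel, norm_one] at this; linarith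
  have hxe : ‖x‖ + ‖ε‖ ≤ 1 / 16 := by linarith
  have hxx : ‖x‖ ^ 2 + ‖ε‖ ^ 2 ≤ Q := by rw [hQ]; nlinarith
  have hT : ‖stepT ε x a - (1 + q * x + r * y)‖ ≤ (20 + C + 9 * K) * Q := by
    have e1 : stepT ε x a - (1 + q * x + r * y) = (stepT ε x a - (a - a ^ 2 * x)) +
        (a - (1 + (q + 1) * x + r * y)) + -((a - 1) * (a + 1) * x) := by ring
    rw [e1]
    refine (norm_add₃_le).trans ?_
    rw [norm_neg, norm_mul, norm_mul]
    have h3 : ‖a + 1‖ ≤ 3 := (norm_add_le _ _).trans (by rw [norm_one]; linarith)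
    have h4 : ‖a - 1‖ * ‖a + 1‖ * ‖x‖ ≤ K * s * 3 * s := by gcongr
    have h5 := norm_stepT_sub_le ha2 hxe
    have h6 : K * s ^ 2 ≤ K * (3 * Q) := by gcongr
    have h7 : (20 + C + 9 * K) * Q = 20 * Q + C * Q + 3 * (K * (3 * Q)) := by ring
    have h8 : K * s * 3 * s = 3 * (K * s ^ 2) := by ring
    linarith
  refine ⟨a, by rw [e], ha2, hxe, ?_, hT.trans ?_, ?_, ?_⟩
  · have e1 : stepT ε x a - 1 = (stepT ε x a - (1 + q * x + r * y)) + q * x + r * y := by ring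
    simp only
    rw [e1]
    refine (norm_add₃_le).trans ?_
    rw [norm_mul, norm_mul]
    have h1 : ‖q‖ * ‖x‖ ≤ ‖q‖ * s := by gcongr
    have h2 : ‖r‖ * ‖y‖ ≤ ‖r‖ * s := by gcongr
    have h3 : (20 + C + 9 * K) * Q ≤ (20 + C + 9 * K) * s := by gcongr; linarith
    have h4 : (20 + C + 9 * K) * s + ‖q‖ * s + ‖r‖ * s = s * K3 / 200 := by rw [hK3]; ring
    linarith
  · gcongr
    rw [hC']; nlinarith [sq_nonneg (|ρ| + C)]
  · have e1 : stepL ε x a - 2 * x = (stepL ε x a - 2 * (x * a)) + 2 * (x * (a - 1)) := by ring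
    simp only
    rw [e1]
    refine (norm_add_le _ _).trans ?_
    have h1 := norm_stepL_sub_le ha2 hxe
    have h2 : ‖2 * (x * (a - 1))‖ ≤ 2 * (s * (K * s)) := by
      rw [norm_mul, norm_mul, Complex.norm_two]; gcongr
    have h6 : K * s ^ 2 ≤ K * (3 * Q) := by gcongr
    have h7 : 0 ≤ (4 + C + 3 * K + 3 * (|ρ| + C) ^ 2) * Q := by positivity
    have h8 : C' * Q = 16 * Q + 6 * (K * Q) + (4 + C + 3 * K + 3 * (|ρ| + C) ^ 2) * Q := by
      rw [hC']; ring
    have h9 : s * (K * s) = K * s ^ 2 := by ring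
    linarith
  · rw [e]
    simp only [norm_mul]
    gcongr
    rw [add_assoc]
    refine (norm_one_add_le_exp _).trans ?_
    rw [Real.exp_le_exp]
    have h1 : (ρ * x + b : ℂ).re ≤ ρ * x.re + C * Q := by
      rw [Complex.add_re, Complex.re_ofReal_mul]
      have := b.re_le_norm; linarith
    have h2 : ‖(ρ * x + b : ℂ)‖ ≤ (|ρ| + C) * s := by
      refine (norm_add_le _ _).trans ?_
      rw [norm_mul, Complex.norm_real, Real.norm_eq_abs]
      calc _ ≤ |ρ| * s + C * s := by
            gcongr; exact hb.trans (by gcongr; linarith)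
        _ = _ := by ring
    have h3 : ‖(ρ * x + b : ℂ)‖ ^ 2 ≤ (|ρ| + C) ^ 2 * (3 * Q) := by
      calc _ ≤ ((|ρ| + C) * s) ^ 2 := by gcongr
        _ = (|ρ| + C) ^ 2 * s ^ 2 := by ring
        _ ≤ _ := by gcongr
    have h7 : 0 ≤ (20 + 9 * K + 3 / 2 * (|ρ| + C) ^ 2) * Q := by positivity
    have h8 : C' * Q = C * Q + (|ρ| + C) ^ 2 * (3 * Q) / 2 +
        (20 + 9 * K + 3 / 2 * (|ρ| + C) ^ 2) * Q := by
      rw [hC']; ring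
    linarith

/-! ### Orbit estimates, uniform in ε -/

/-- Admissible initial data for following an orbit during `m` steps. -/
structure Start (τ σ : ℝ) (ε : ℂ) (p : ℂ × ℂ) (m : ℕ) (T₀ : ℂ) : Prop where
  rel : Rel ε p.1 T₀
  le_re : τ ≤ T₀.re
  im_le : |T₀.im| ≤ T₀.re / 200
  y_le : ‖p.2‖ * T₀.re ≤ σ
  eps_im : |ε.im| ≤ ε.re / 100
  eps_le : ‖ε‖ * (‖T₀‖ + 201 / 200 * m) ≤ 9 / 5

/-- The estimates satisfied by the `j`-th point of an orbit with translation coordinate `T`. -/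
structure Inv (ρ : ℝ) (F : ℂ → ℂ × ℂ → ℂ × ℂ) (C₁ : ℝ) (ε : ℂ) (p : ℂ × ℂ) (T₀ : ℂ) (j : ℕ)
    (T : ℂ) : Prop where
  rel : Rel ε ((F ε)^[j] p).1 T
  near : ‖T - T₀ - j‖ ≤ j / 200
  y_le : ‖((F ε)^[j] p).2‖ * ‖p.1 ^ 2 + ε ^ 2‖ ^ (ρ / 2) ≤
    ‖p.2‖ * ‖((F ε)^[j] p).1 ^ 2 + ε ^ 2‖ ^ (ρ / 2) * Real.exp (C₁ * (1 - 1 / (j + 1)))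

section Orbit

variable {τ σ C₁ : ℝ} {ε T₀ T : ℂ} {p : ℂ × ℂ} {m j : ℕ}

/-- Each step moves `T` by 1 with error at most `1/200`, so a start with slope `1/200` stays within
slope `1/100`; `eps_le` is the budget keeping `|εT| ≤ 9/5` for all `m` steps. -/
theorem Start.region (hS : Start τ σ ε p m T₀) (hτ : 1 ≤ τ) (hj : j ≤ m)
    (hn : ‖T - T₀ - j‖ ≤ j / 200) : Region ε T ∧ T₀.re + j / 2 ≤ T.re := by
  have h1 := (Complex.abs_re_le_norm _).trans hn
  have h2 := (Complex.abs_im_le_norm _).trans hn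
  simp only [Complex.sub_re, Complex.sub_im, Complex.natCast_re, Complex.natCast_im,
    sub_zero] at h1 h2
  have hj0 : (0 : ℝ) ≤ j := Nat.cast_nonneg j
  have h3 := abs_le.mp hS.im_le
  have h4 := hS.le_re
  rw [abs_le] at h1 h2
  refine ⟨⟨by linarith, by rw [abs_le]; constructor <;> linarith, hS.eps_im, ?_⟩, by linarith⟩
  rw [norm_mul]
  refine le_trans ?_ hS.eps_le
  gcongr
  have e : T = (T - T₀ - j) + T₀ + j := by ring
  rw [e]
  refine norm_add₃_le.trans ?_
  rw [Complex.norm_natCast]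
  have : (j : ℝ) ≤ m := by exact_mod_cast hj
  linarith

theorem Start.region_zero (hS : Start τ σ ε p m T₀) (hτ : 1 ≤ τ) : Region ε T₀ :=
  (hS.region (j := 0) hτ (Nat.zero_le _) (by simp)).1

theorem Inv.norm_snd_le (hI : Inv ρ F C₁ ε p T₀ j T) (hρ : 0 < ρ) (hC : 0 ≤ C₁)
    (hS : Start τ σ ε p m T₀) (hτ : 1 ≤ τ) (hj : j ≤ m) :
    ‖((F ε)^[j] p).2‖ ≤ 32 ^ ρ * Real.exp C₁ * ‖p.2‖ * (T₀.re / ‖T‖) ^ ρ := by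
  have hR0 := hS.region_zero hτ
  obtain ⟨hR, -⟩ := hS.region hτ hj hI.near
  have g0 := (hR0.norm_sq_add_sq hS.rel).1
  have gj := (hR.norm_sq_add_sq hI.rel).2
  have hT := hR.norm_pos
  have hT0 := hR0.norm_pos
  have hre := hR0.re_pos
  have hT0' : ‖T₀‖ ≤ 2 * T₀.re := by
    have h1 := Complex.norm_le_abs_re_add_abs_im T₀
    rw [abs_of_pos hre] at h1
    linarith [hS.im_le]
  set g := ‖p.1 ^ 2 + ε ^ 2‖
  have hg : 0 < g := lt_of_lt_of_le (by positivity) g0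
  -- The two-sided bound on `x² + ε²`, with `‖T₀‖ ≤ 2 Re T₀`, gives the ratio `16 · 64 (Re T₀ /
  -- ‖T‖)²`, and `16 · 64 = 32²`.
  set l := 32 * (T₀.re / ‖T‖) with hl
  have hl0 : 0 ≤ l := by positivity
  have h1 : ‖((F ε)^[j] p).1 ^ 2 + ε ^ 2‖ ≤ l ^ 2 * g := by
    refine gj.trans ?_
    have : 1 / (64 * T₀.re ^ 2) ≤ g := by
      refine le_trans ?_ g0
      apply one_div_le_one_div_of_le (by positivity)
      nlinarith
    calc 16 / ‖T‖ ^ 2 = l ^ 2 * (1 / (64 * T₀.re ^ 2)) := by rw [hl]; field_simp; norm_num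
      _ ≤ _ := by gcongr
  have h2 : ‖((F ε)^[j] p).1 ^ 2 + ε ^ 2‖ ^ (ρ / 2) ≤ l ^ ρ * g ^ (ρ / 2) := by
    refine (Real.rpow_le_rpow (norm_nonneg _) h1 (by positivity)).trans_eq ?_
    rw [Real.mul_rpow (by positivity) hg.le, ← Real.rpow_natCast_mul hl0]
    congr 2; push_cast; ring
  have h3 : Real.exp (C₁ * (1 - 1 / ((j : ℝ) + 1))) ≤ Real.exp C₁ := by
    rw [Real.exp_le_exp]
    have : (0 : ℝ) ≤ 1 / ((j : ℝ) + 1) := by positivity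
    nlinarith
  have h4 : ‖((F ε)^[j] p).2‖ * g ^ (ρ / 2) ≤
      (32 ^ ρ * Real.exp C₁ * ‖p.2‖ * (T₀.re / ‖T‖) ^ ρ) * g ^ (ρ / 2) := by
    refine hI.y_le.trans ?_
    calc _ ≤ ‖p.2‖ * (l ^ ρ * g ^ (ρ / 2)) * Real.exp C₁ := by gcongr
      _ = _ := by rw [hl, Real.mul_rpow (by norm_num) (by positivity)]; ring
  exact le_of_mul_le_mul_right h4 (by positivity)

/-- The bound on `‖p.2‖ Re T₀` is the reciprocal of the constant in `norm_snd_le`; with `ρ ≥ 1` this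
leaves `1 / ‖T‖`, so `x`, `y` and `ε` are all `O(1/‖T‖)`. -/
theorem Inv.bounds (hI : Inv ρ F C₁ ε p T₀ j T) (hρ : 1 ≤ ρ) (hC : 0 ≤ C₁)
    (hS : Start τ (1 / (32 ^ ρ * Real.exp C₁)) ε p m T₀) (hτ : 1 ≤ τ) (hj : j ≤ m) :
    ‖((F ε)^[j] p).1‖ ≤ 10 / ‖T‖ ∧ ‖((F ε)^[j] p).2‖ ≤ 1 / ‖T‖ ∧ ‖ε‖ ≤ 2 / ‖T‖ ∧
      τ + j / 2 ≤ ‖T‖ := by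
  obtain ⟨hR, h1⟩ := hS.region hτ hj hI.near
  have hT := hR.norm_pos
  have hle : T₀.re + j / 2 ≤ ‖T‖ := h1.trans (Complex.re_le_norm _)
  have hj0 : (0 : ℝ) ≤ j := Nat.cast_nonneg j
  have hre := (hS.region_zero hτ).re_pos
  refine ⟨hR.norm_x_le hI.rel, ?_, hR.norm_eps_le, by linarith [hS.le_re]⟩
  refine (hI.norm_snd_le (by linarith) hC hS hτ hj).trans ?_
  have h2 : (T₀.re / ‖T‖) ^ ρ ≤ T₀.re / ‖T‖ := by
    refine Real.rpow_le_self_of_le_one (by positivity) ?_ hρ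
    rw [div_le_one hT]; linarith
  calc _ ≤ 32 ^ ρ * Real.exp C₁ * ‖p.2‖ * (T₀.re / ‖T‖) := by gcongr
    _ = 32 ^ ρ * Real.exp C₁ * (‖p.2‖ * T₀.re) / ‖T‖ := by ring
    _ ≤ 32 ^ ρ * Real.exp C₁ * (1 / (32 ^ ρ * Real.exp C₁)) / ‖T‖ := by
      have := hS.y_le; gcongr
    _ = 1 / ‖T‖ := by field_simp

/-- The constant `C₁` used for the orbit estimates. -/
noncomputable def orbitConst (ρ C : ℝ) : ℝ := 420 * (1 + ρ / 2) * C

/-- The lower bound `τ` used for the orbit estimates. -/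
noncomputable def orbitTau (δ : ℝ) : ℝ := 1 + 10 / δ

/-- The bound `σ` used for the orbit estimates. -/
noncomputable def orbitSigma (ρ C : ℝ) : ℝ := 1 / (32 ^ ρ * Real.exp (orbitConst ρ C))

theorem one_le_orbitTau (hδ : 0 < δ) : 1 ≤ orbitTau δ := by
  rw [orbitTau]; have : 0 < 10 / δ := by positivity
  linarith

theorem orbitSigma_pos : 0 < orbitSigma ρ C := by rw [orbitSigma]; positivity

/-- `orbitTau` is chosen to make `10 / ‖T‖ < δ`, and `105 = 10² + 1² + 2²` collects the three
bounds. -/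
theorem Inv.small (hI : Inv ρ F (orbitConst ρ C) ε p T₀ j T) (hF : StepBound ρ q r F C δ)
    (hρ : 1 ≤ ρ) (hS : Start (orbitTau δ) (orbitSigma ρ C) ε p m T₀) (hj : j ≤ m) :
    ‖((F ε)^[j] p).1‖ < δ ∧ ‖((F ε)^[j] p).2‖ < δ ∧ ‖ε‖ < δ ∧
    ‖((F ε)^[j] p).1‖ ^ 2 + ‖((F ε)^[j] p).2‖ ^ 2 + ‖ε‖ ^ 2 ≤ 105 / ‖T‖ ^ 2 ∧
    1 + j / 2 ≤ ‖T‖ := by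
  have hC1 : 0 ≤ orbitConst ρ C := by
    have := hF.nonneg; rw [orbitConst]; positivity
  have hδ := hF.pos
  have hτ := one_le_orbitTau hδ
  obtain ⟨h1, h2, h3, h4⟩ := hI.bounds hρ hC1 hS hτ hj
  have hj0 : (0 : ℝ) ≤ j := Nat.cast_nonneg j
  have hT : 0 < ‖T‖ := by linarith
  have h5 : 10 / ‖T‖ < δ := by
    rw [div_lt_iff₀ hT]
    have : 10 / δ < ‖T‖ := by rw [orbitTau] at h4; linarith
    rw [div_lt_iff₀ hδ] at this; linarith
  have h6 : 1 / ‖T‖ ≤ 10 / ‖T‖ := by gcongr; norm_num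
  have h7 : 2 / ‖T‖ ≤ 10 / ‖T‖ := by gcongr; norm_num
  refine ⟨by linarith, by linarith, by linarith, ?_, by linarith⟩
  calc _ ≤ (10 / ‖T‖) ^ 2 + (1 / ‖T‖) ^ 2 + (2 / ‖T‖) ^ 2 := by gcongr
    _ = _ := by ring

/-- The quotient `|y| / |x² + ε²|^{ρ/2}` is almost invariant: the contributions `ρ Re x` of
numerator and denominator cancel, leaving a factor at most `exp(O(1/‖T‖²))`. -/
theorem Inv.step (hI : Inv ρ F (orbitConst ρ C) ε p T₀ j T) (hF : StepBound ρ q r F C δ)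
    (hρ : 1 ≤ ρ) (hS : Start (orbitTau δ) (orbitSigma ρ C) ε p m T₀) (hj : j ≤ m) :
    ∃ a : ℂ, ((F ε)^[j + 1] p).1 =
        ((F ε)^[j] p).1 + (((F ε)^[j] p).1 ^ 2 + ε ^ 2) * a ∧
      ‖a‖ ≤ 2 ∧ ‖((F ε)^[j] p).1‖ + ‖ε‖ ≤ 1 / 16 ∧
      ‖stepT ε ((F ε)^[j] p).1 a - (1 + q * ((F ε)^[j] p).1 + r * ((F ε)^[j] p).2)‖ ≤
        C * (105 / ‖T‖ ^ 2) ∧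
      ‖stepL ε ((F ε)^[j] p).1 a - 2 * ((F ε)^[j] p).1‖ ≤ C * (105 / ‖T‖ ^ 2) ∧
      Inv ρ F (orbitConst ρ C) ε p T₀ (j + 1) (T + stepT ε ((F ε)^[j] p).1 a) := by
  obtain ⟨s1, s2, s3, s4, s5⟩ := hI.small hF hρ hS hj
  obtain ⟨a, e, a1, a2, a3, a4, a5, a6⟩ := hF.step ε _ s3 s1 s2
  rw [← Function.iterate_succ_apply' (F ε)] at e a6
  have hC := hF.nonneg
  set P := (F ε)^[j] p with hP
  set P' := (F ε)^[j + 1] p with hP'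
  have hQ : C * (‖P.1‖ ^ 2 + ‖P.2‖ ^ 2 + ‖ε‖ ^ 2) ≤ C * (105 / ‖T‖ ^ 2) := by gcongr
  refine ⟨a, e, a1, a2, a4.trans hQ, a5.trans hQ, ?_, ?_, ?_⟩
  · rw [← hP', e]; exact rel_step hI.rel a1 a2
  · have e1 : T + stepT ε P.1 a - T₀ - ((j + 1 : ℕ) : ℂ) =
        (T - T₀ - j) + (stepT ε P.1 a - 1) := by push_cast; ring
    rw [e1]
    refine (norm_add_le _ _).trans ?_
    have := hI.near
    push_cast
    linarith
  · rw [← hP']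
    have hy := hI.y_le
    rw [← hP] at hy
    set g := ‖P.1 ^ 2 + ε ^ 2‖ with hg
    set g' := ‖P'.1 ^ 2 + ε ^ 2‖ with hg'
    set C₁ := orbitConst ρ C with hC1
    set D := C * (105 / ‖T‖ ^ 2) with hD
    have hg1 : g' = g * Real.exp (stepL ε P.1 a).re := by
      rw [hg', e, exp_stepL a1 a2, norm_mul, Complex.norm_exp]
    have hre : 2 * P.1.re - D ≤ (stepL ε P.1 a).re := by
      have h1 := abs_le.mp ((Complex.abs_re_le_norm _).trans (a5.trans hQ))
      simp only [Complex.sub_re, Complex.mul_re, Complex.re_ofNat, Complex.im_ofNat, zero_mul,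
        sub_zero] at h1
      linarith
    have hg2 : g ^ (ρ / 2) * Real.exp (ρ * P.1.re - ρ / 2 * D) ≤ g' ^ (ρ / 2) := by
      rw [hg1, Real.mul_rpow (norm_nonneg _) (Real.exp_nonneg _), ← Real.exp_mul]
      gcongr
      nlinarith
    have hy2 : ‖P'.2‖ ≤ ‖P.2‖ * Real.exp (ρ * P.1.re + D) := a6.trans (by gcongr)
    have hj0 : (0 : ℝ) ≤ j := Nat.cast_nonneg j
    -- As `‖T‖ ≥ 1 + j/2`, the error is bounded by a telescoping difference. The exponent `C₁ (1 -
    -- 1/(j + 1))` in `Inv` is the sum of these differences; `420 = 4 · 105`.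
    have hsum : (1 + ρ / 2) * D ≤ C₁ * (1 / (j + 1) - 1 / (j + 1 + 1)) := by
      have h1 : 1 / ‖T‖ ^ 2 ≤ 4 * (1 / ((j : ℝ) + 1) - 1 / ((j : ℝ) + 1 + 1)) := by
        calc 1 / ‖T‖ ^ 2 ≤ 1 / (1 + (j : ℝ) / 2) ^ 2 := by gcongr
          _ = 4 * (1 / ((j : ℝ) + 2) ^ 2) := by field_simp; ring
          _ ≤ 4 * (1 / (((j : ℝ) + 1) * ((j : ℝ) + 2))) := by gcongr; nlinarith
          _ = _ := by field_simp; ring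
      calc (1 + ρ / 2) * D = 105 * (1 + ρ / 2) * C * (1 / ‖T‖ ^ 2) := by rw [hD]; ring
        _ ≤ 105 * (1 + ρ / 2) * C * (4 * (1 / (j + 1) - 1 / (j + 1 + 1))) := by gcongr
        _ = _ := by rw [hC1, orbitConst]; ring
    calc ‖P'.2‖ * ‖p.1 ^ 2 + ε ^ 2‖ ^ (ρ / 2)
        ≤ ‖P.2‖ * Real.exp (ρ * P.1.re + D) * ‖p.1 ^ 2 + ε ^ 2‖ ^ (ρ / 2) := by gcongr
      _ = ‖P.2‖ * ‖p.1 ^ 2 + ε ^ 2‖ ^ (ρ / 2) * Real.exp (ρ * P.1.re + D) := by ring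
      _ ≤ ‖p.2‖ * g ^ (ρ / 2) * Real.exp (C₁ * (1 - 1 / (j + 1))) *
            Real.exp (ρ * P.1.re + D) := by gcongr
      _ = ‖p.2‖ * (g ^ (ρ / 2) * Real.exp (ρ * P.1.re - ρ / 2 * D)) *
            Real.exp (C₁ * (1 - 1 / (j + 1)) + (1 + ρ / 2) * D) := by
          have hE : Real.exp (C₁ * (1 - 1 / (j + 1))) * Real.exp (ρ * P.1.re + D) =
              Real.exp (ρ * P.1.re - ρ / 2 * D) *
                Real.exp (C₁ * (1 - 1 / (j + 1)) + (1 + ρ / 2) * D) := by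
            rw [← Real.exp_add, ← Real.exp_add]; ring_nf
          linear_combination (‖p.2‖ * g ^ (ρ / 2)) * hE
      _ ≤ ‖p.2‖ * g' ^ (ρ / 2) * Real.exp (C₁ * (1 - 1 / (j + 1)) +
            C₁ * (1 / (j + 1) - 1 / (j + 1 + 1))) := by gcongr
      _ = _ := by push_cast; ring_nf

theorem Start.exists_inv (hS : Start (orbitTau δ) (orbitSigma ρ C) ε p m T₀)
    (hF : StepBound ρ q r F C δ) (hρ : 1 ≤ ρ) :
    ∀ j ≤ m, ∃ T, Inv ρ F (orbitConst ρ C) ε p T₀ j T := by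
  intro j
  induction j with
  | zero =>
    intro _
    exact ⟨T₀, by simpa using hS.rel, by simp, by simp⟩
  | succ j ih =>
    intro hj
    obtain ⟨T, hT⟩ := ih (by omega)
    obtain ⟨a, -, -, -, -, -, h⟩ := hT.step hF hρ hS (by omega)
    exact ⟨_, h⟩

end Orbit

/-! ### Summable increments of the almost Fatou coordinates -/

/-- Bound for the `j`-th increment of the almost Fatou coordinates. -/
noncomputable def stepErr (ρ : ℝ) (q r : ℂ) (C Λ : ℝ) (j : ℕ) : ℝ :=
  420 * C * (1 + ‖q‖ / 2) * (1 / ((j : ℝ) + 1) ^ 2) +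
    ‖r‖ * (2 * Λ) ^ ρ * (1 / ((j : ℝ) + 1) ^ ρ)

/-- The strict inequality `ρ > 1` is needed here; the orbit estimates use only `ρ ≥ 1`. -/
theorem summable_stepErr (hρ : 1 < ρ) (Λ : ℝ) : Summable (stepErr ρ q r C Λ) := by
  apply Summable.add <;> apply Summable.mul_left
  · have := (summable_nat_add_iff 1).mpr (Real.summable_one_div_nat_pow.mpr one_lt_two)
    simpa using this
  · have := (summable_nat_add_iff 1).mpr (Real.summable_one_div_nat_rpow.mpr hρ)
    simpa using this

theorem stepErr_nonneg (hC : 0 ≤ C) {Λ : ℝ} (hΛ : 0 ≤ Λ) (j : ℕ) : 0 ≤ stepErr ρ q r C Λ j := by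
  rw [stepErr]; positivity

/-- The almost Fatou coordinates `φ̃^ι_{ε,n}`, including `ε = 0`. -/
noncomputable def phi (q : ℂ) (F : ℂ → ℂ × ℂ → ℂ × ℂ) (ε : ℂ) (n : ℕ) (p : ℂ × ℂ) : ℂ :=
  wI q ε ((F ε)^[n] p) - n

theorem phi_zero_eq (q : ℂ) (F : ℂ → ℂ × ℂ → ℂ × ℂ) (n : ℕ) (p : ℂ × ℂ) :
    phi q F 0 n p = phiIn0 q F n p := by
  rw [phi, wI, if_pos rfl, phiIn0]

theorem phi_eq {ε : ℂ} (hε : ε ≠ 0) (q : ℂ) (F : ℂ → ℂ × ℂ → ℂ × ℂ) (n : ℕ) (p : ℂ × ℂ) :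
    phi q F ε n p = phiIn q F ε n p := by
  rw [phi, wI, if_neg hε, phiIn]

section Increments

variable {ε T₀ T : ℂ} {p : ℂ × ℂ} {m j : ℕ} {Λ : ℝ}

theorem Inv.norm_snd_le_rpow (hI : Inv ρ F (orbitConst ρ C) ε p T₀ j T)
    (hF : StepBound ρ q r F C δ) (hρ : 1 ≤ ρ)
    (hS : Start (orbitTau δ) (orbitSigma ρ C) ε p m T₀) (hj : j ≤ m) (hΛ : T₀.re ≤ Λ) :
    ‖((F ε)^[j] p).2‖ ≤ (2 * Λ) ^ ρ * (1 / ((j : ℝ) + 1) ^ ρ) := by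
  have hC1 : 0 ≤ orbitConst ρ C := by
    have := hF.nonneg; rw [orbitConst]; positivity
  have hτ := one_le_orbitTau hF.pos
  obtain ⟨-, -, -, -, s5⟩ := hI.small hF hρ hS hj
  have hre : 1 ≤ T₀.re := hτ.trans hS.le_re
  have hj0 : (0 : ℝ) ≤ j := Nat.cast_nonneg j
  refine (hI.norm_snd_le (by linarith) hC1 hS hτ hj).trans ?_
  have h1 : ‖p.2‖ ≤ orbitSigma ρ C := by
    refine le_trans ?_ hS.y_le
    exact le_mul_of_one_le_right (norm_nonneg _) hre
  have h2 : T₀.re / ‖T‖ ≤ 2 * Λ / (j + 1) := by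
    calc T₀.re / ‖T‖ ≤ Λ / (((j : ℝ) + 1) / 2) := by gcongr <;> linarith
      _ = _ := by field_simp
  calc _ ≤ 32 ^ ρ * Real.exp (orbitConst ρ C) * orbitSigma ρ C * (2 * Λ / (j + 1)) ^ ρ := by
        have := orbitSigma_pos (ρ := ρ) (C := C)
        gcongr
    _ = (2 * Λ / (j + 1)) ^ ρ := by rw [orbitSigma]; field_simp
    _ = _ := by rw [Real.div_rpow (by linarith) (by positivity)]; ring

/-- In the increment the term `qx` of `stepT` cancels against `(q/2) · 2x` from `stepL`. Only `ry`,
of order `(j + 1)^{-ρ}`, and quadratic remainders, of order `(j + 1)⁻²`, survive. -/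
theorem Start.dist_phi_succ_le (hS : Start (orbitTau δ) (orbitSigma ρ C) ε p m T₀)
    (hF : StepBound ρ q r F C δ) (hρ : 1 ≤ ρ) (hj : j < m) (hΛ : T₀.re ≤ Λ) :
    dist (phi q F ε j p) (phi q F ε (j + 1) p) ≤ stepErr ρ q r C Λ j := by
  have hτ := one_le_orbitTau hF.pos
  obtain ⟨T, hI⟩ := hS.exists_inv hF hρ j hj.le
  obtain ⟨a, e, a1, a2, a4, a5, hI'⟩ := hI.step hF hρ hS hj.le
  have hy := hI.norm_snd_le_rpow hF hρ hS hj.le hΛ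
  obtain ⟨-, -, -, -, s5⟩ := hI.small hF hρ hS hj.le
  have hR := (hS.region hτ hj.le hI.near).1
  have hR' := (hS.region hτ hj hI'.near).1
  have hC := hF.nonneg
  have hj0 : (0 : ℝ) ≤ j := Nat.cast_nonneg j
  rw [dist_comm, dist_eq_norm, phi, phi, wI_eq q hR hI.rel, wI_eq q hR' hI'.rel, e,
    log_step a1 a2 (hR.re_sq_add_sq_pos hI.rel)]
  set x := ((F ε)^[j] p).1
  set y := ((F ε)^[j] p).2
  have e2 : T + stepT ε x a - q / 2 * (Complex.log (x ^ 2 + ε ^ 2) + stepL ε x a) -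
      ((j + 1 : ℕ) : ℂ) - (T - q / 2 * Complex.log (x ^ 2 + ε ^ 2) - j) =
      (stepT ε x a - (1 + q * x + r * y)) + -(q / 2 * (stepL ε x a - 2 * x)) + r * y := by
    push_cast; ring
  rw [e2]
  refine norm_add₃_le.trans ?_
  rw [norm_neg, norm_mul, norm_mul, norm_div, Complex.norm_two]
  have h1 : 105 / ‖T‖ ^ 2 ≤ 420 * (1 / ((j : ℝ) + 1) ^ 2) := by
    calc 105 / ‖T‖ ^ 2 ≤ 105 / (((j : ℝ) + 1) / 2) ^ 2 := by gcongr; linarith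
      _ = _ := by field_simp; norm_num
  calc _ ≤ C * (420 * (1 / ((j : ℝ) + 1) ^ 2)) +
        ‖q‖ / 2 * (C * (420 * (1 / ((j : ℝ) + 1) ^ 2))) +
        ‖r‖ * ((2 * Λ) ^ ρ * (1 / ((j : ℝ) + 1) ^ ρ)) := by
        gcongr
        · exact a4.trans (by gcongr)
        · exact a5.trans (by gcongr)
    _ = _ := by rw [stepErr]; ring

/-- The tail depends on the start only through the bound `Λ` on `Re T₀`, not on `ε` or `m`: this is
the domination in Tannery's argument. -/
theorem Start.dist_phi_le_tsum (hS : Start (orbitTau δ) (orbitSigma ρ C) ε p m T₀)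
    (hF : StepBound ρ q r F C δ) (hρ : 1 < ρ) {N : ℕ} (hN : N ≤ m) (hΛ : T₀.re ≤ Λ) :
    dist (phi q F ε N p) (phi q F ε m p) ≤ ∑' k, stepErr ρ q r C Λ (k + N) := by
  have hΛ0 : 0 ≤ Λ := by
    have := one_le_orbitTau hF.pos; have := hS.le_re; linarith
  refine (dist_le_Ico_sum_of_dist_le hN (f := fun j => phi q F ε j p)
    (fun _ h => hS.dist_phi_succ_le hF hρ.le h hΛ)).trans ?_
  rw [Finset.sum_Ico_eq_sum_range]
  simp_rw [add_comm N]
  exact Summable.sum_le_tsum _ (fun _ _ => stepErr_nonneg hF.nonneg hΛ0 _)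
    ((summable_nat_add_iff N).mpr (summable_stepErr hρ Λ))

end Increments

/-! ### Sectors and admissible starting points -/

/-- The opening of the sectors used below. -/
noncomputable def openingBound : ℝ := 1 / 1000

/-- The radius of the sectors used below. -/
noncomputable def radiusBound (δ : ℝ) : ℝ := 1 / (4 * orbitTau δ)

/-- The slope of the sectors used below. -/
noncomputable def slopeBound (ρ C : ℝ) : ℝ := orbitSigma ρ C / 2

/-- The largest sector to which the estimates apply. -/
noncomputable abbrev bigSector (ρ C δ : ℝ) : Set (ℂ × ℂ) :=
  sector openingBound (radiusBound δ) (slopeBound ρ C)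

theorem sector_re_neg {γ R s : ℝ} {p : ℂ × ℂ} (hγ : 0 < γ) (hp : p ∈ sector γ R s) :
    p.1.re < 0 := by
  obtain ⟨h1, h2, -, -⟩ := hp
  have h3 := abs_nonneg p.1.im
  by_contra h
  have h4 : p.1.re = 0 := by nlinarith
  rw [h4] at h2
  have h5 : p.1.im = 0 := abs_nonpos_iff.mp (by linarith)
  exact h1 (Complex.ext h4 h5)

/-- The inversion `x ↦ -1/x` carries the sector about the negative axis to one of the same opening
about the positive axis. Opening and relative perturbation `1/1000` fit within slope `1/200`; the
factor 4 in `radiusBound` gives room for `Re T₀ ≥ τ`, and the factor 2 in `slopeBound` pays for `Re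
T₀ ≤ 2/|x|`. -/
theorem start_of_near {ε T₀ : ℂ} {p : ℂ × ℂ} {m : ℕ} (hδ : 0 < δ) (hp : p ∈ bigSector ρ C δ)
    (hr : Rel ε p.1 T₀) (hn : ‖T₀ - -1 / p.1‖ ≤ 1 / 1000 * (1 / ‖p.1‖))
    (him : |ε.im| ≤ ε.re / 100) (hm : ‖ε‖ * (2 / ‖p.1‖ + 201 / 200 * m) ≤ 9 / 5) :
    Start (orbitTau δ) (orbitSigma ρ C) ε p m T₀ ∧ T₀.re ≤ 2 / ‖p.1‖ := by
  have hre := sector_re_neg (by norm_num [openingBound]) hp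
  obtain ⟨hx, h1, h2, h3⟩ := hp
  rw [openingBound] at h1
  have hxn : 0 < ‖p.1‖ := norm_pos_iff.mpr hx
  have hτ := one_le_orbitTau hδ
  set V := -1 / p.1 with hV
  have hN : 0 < Complex.normSq p.1 := Complex.normSq_pos.mpr hx
  have e1 : V.re = -p.1.re / Complex.normSq p.1 := by
    rw [hV, neg_div, one_div, Complex.neg_re, Complex.inv_re]; ring
  have e2 : V.im = p.1.im / Complex.normSq p.1 := by
    rw [hV, neg_div, one_div, Complex.neg_im, Complex.inv_im]; ring
  have hVn : ‖V‖ = 1 / ‖p.1‖ := by rw [hV, norm_div, norm_neg, norm_one]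
  have hVre : 0 < V.re := by rw [e1]; apply div_pos _ hN; linarith
  have hVim : |V.im| ≤ V.re / 1000 := by
    rw [e1, e2, abs_div, abs_of_pos hN, div_right_comm]
    gcongr; linarith
  have hVle : ‖V‖ ≤ 1.001 * V.re := by
    have := Complex.norm_le_abs_re_add_abs_im V
    rw [abs_of_pos hVre] at this; linarith
  rw [← hVn] at hn
  have t1 := abs_le.mp ((Complex.abs_re_le_norm _).trans hn)
  have t2 := abs_le.mp ((Complex.abs_im_le_norm _).trans hn)
  rw [Complex.sub_re] at t1
  rw [Complex.sub_im] at t2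
  have t3 := abs_le.mp hVim
  have t4 := Complex.re_le_norm V
  have t5 : ‖T₀‖ ≤ 2 * ‖V‖ := by
    have := norm_add_le (T₀ - V) V
    rw [sub_add_cancel] at this; linarith [norm_nonneg V]
  have t6 : 2 * ‖V‖ = 2 / ‖p.1‖ := by rw [hVn]; ring
  have t7 : 4 * orbitTau δ ≤ ‖V‖ := by
    rw [hVn, le_div_iff₀ hxn]
    rw [radiusBound, le_div_iff₀ (by positivity)] at h2
    linarith
  refine ⟨⟨hr, by linarith, by rw [abs_le]; constructor <;> linarith, ?_, him, ?_⟩, ?_⟩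
  · calc ‖p.2‖ * T₀.re ≤ (slopeBound ρ C * ‖p.1‖) * (2 / ‖p.1‖) := by
          gcongr
          · linarith
          · exact (norm_nonneg _).trans h3
          · exact (Complex.re_le_norm _).trans (by linarith)
      _ = _ := by rw [slopeBound]; field_simp
  · refine le_trans ?_ hm
    gcongr; linarith
  · linarith

theorem div_re_neg {p : ℂ × ℂ} {ε : ℂ} (hre : p.1.re < 0) (him : |p.1.im| ≤ -p.1.re)
    (hε : ε ≠ 0) (hc : |ε.im| ≤ ε.re / 100) : (ε / p.1).re < 0 := by
  have h0 : 0 < ε.re := by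
    have := abs_nonneg ε.im
    rcases (show 0 ≤ ε.re by linarith).lt_or_eq with h | h
    · exact h
    · exfalso
      rw [← h] at hc
      exact hε (Complex.ext h.symm (abs_nonpos_iff.mp (by linarith)))
  have hx : p.1 ≠ 0 := by intro h; rw [h] at hre; simp at hre
  have hN : 0 < Complex.normSq p.1 := Complex.normSq_pos.mpr hx
  have e : (ε / p.1).re = (ε.re * p.1.re + ε.im * p.1.im) / Complex.normSq p.1 := by
    rw [Complex.div_re]; ring
  rw [e]
  apply div_neg_of_neg_of_pos _ hN
  have h1 : |ε.im * p.1.im| ≤ ε.re / 100 * -p.1.re := by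
    rw [abs_mul]; gcongr
  have := le_abs_self (ε.im * p.1.im)
  nlinarith [mul_pos h0 (neg_pos.mpr hre)]

/-- The translation coordinate, including `ε = 0`. -/
noncomputable def coordT (ε x : ℂ) : ℂ := if ε = 0 then -1 / x else u ε x + Real.pi / (2 * ε)

theorem coordT_spec {p : ℂ × ℂ} {ε : ℂ} (hre : p.1.re < 0) (him : |p.1.im| ≤ -p.1.re)
    (hc : |ε.im| ≤ ε.re / 100) (hs : ‖ε‖ ≤ ‖p.1‖ / 8) :
    Rel ε p.1 (coordT ε p.1) ∧ ‖coordT ε p.1 - -1 / p.1‖ ≤ ‖ε‖ / ‖p.1‖ ^ 2 := by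
  have hx : p.1 ≠ 0 := by intro h; rw [h] at hre; simp at hre
  by_cases hε : ε = 0
  · subst hε
    rw [coordT, if_pos rfl]
    refine ⟨⟨fun _ => by field_simp, by simp⟩, by simp⟩
  · rw [coordT, if_neg hε]
    exact exists_initial hε hx hs (div_re_neg hre him hε hc)

theorem exists_start {ε : ℂ} {p : ℂ × ℂ} {m : ℕ} (hδ : 0 < δ) (hp : p ∈ bigSector ρ C δ)
    (hs : ‖ε‖ ≤ ‖p.1‖ / 1000) (him : |ε.im| ≤ ε.re / 100)
    (hm : ‖ε‖ * (2 / ‖p.1‖ + 201 / 200 * m) ≤ 9 / 5) :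
    ∃ T₀, Start (orbitTau δ) (orbitSigma ρ C) ε p m T₀ ∧ T₀.re ≤ 2 / ‖p.1‖ := by
  have hre := sector_re_neg (by norm_num [openingBound]) hp
  have hxn : 0 < ‖p.1‖ := norm_pos_iff.mpr hp.1
  have h1 := hp.2.1
  rw [openingBound] at h1
  obtain ⟨hr, hn⟩ := coordT_spec hre (by linarith) him (by linarith)
  refine ⟨_, start_of_near hδ hp hr (hn.trans ?_) him hm⟩
  calc ‖ε‖ / ‖p.1‖ ^ 2 ≤ (‖p.1‖ / 1000) / ‖p.1‖ ^ 2 := by gcongr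
    _ = _ := by field_simp

theorem wI_eq_coordT {p : ℂ × ℂ} {ε : ℂ} (q : ℂ) (hre : p.1.re < 0) :
    wI q ε p = coordT ε p.1 - q / 2 * Complex.log (p.1 ^ 2 + ε ^ 2) := by
  by_cases hε : ε = 0
  · subst hε
    rw [wI, if_pos rfl, coordT, if_pos rfl, wIn0, show p.1 ^ 2 + (0 : ℂ) ^ 2 = p.1 ^ 2 by ring,
      log_sq_of_re_neg hre]
    ring
  · rw [wI, if_neg hε, coordT, if_neg hε, wIn, w, add_comm (ε ^ 2)]
    ring

/-! ### Convergence as ε → 0 for a fixed number of iterates -/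

section Limits

variable {ι : Type*} {L : Filter ι} {e : ι → ℂ} {P : ι → ℂ × ℂ} {p : ℂ × ℂ}

/-- The singular terms combine into `coordT`, which differs from `-1/x` by at most `|ε|/|x|²`; the
remaining logarithm is continuous because `Re x² > 0`. -/
theorem tendsto_wI (q : ℂ) (he : Tendsto e L (𝓝 0)) (hc : ∀ᶠ i in L, |(e i).im| ≤ (e i).re / 100)
    (hP : Tendsto P L (𝓝 p)) (hre : p.1.re < 0) (him : |p.1.im| ≤ -p.1.re / 2) :
    Tendsto (fun i => wI q (e i) (P i)) L (𝓝 (wI q 0 p)) := by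
  have hx : p.1 ≠ 0 := by intro h; rw [h] at hre; simp at hre
  have hxn : 0 < ‖p.1‖ := norm_pos_iff.mpr hx
  have hP1 : Tendsto (fun i => (P i).1) L (𝓝 p.1) := (continuous_fst.tendsto p).comp hP
  have hPre : Tendsto (fun i => (P i).1.re) L (𝓝 p.1.re) :=
    (Complex.continuous_re.tendsto _).comp hP1
  have hPim : Tendsto (fun i => |(P i).1.im|) L (𝓝 |p.1.im|) :=
    ((Complex.continuous_im.tendsto _).comp hP1).abs
  have ev1 : ∀ᶠ i in L, (P i).1.re < 0 := hPre.eventually_lt_const hre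
  have ev2 : ∀ᶠ i in L, |(P i).1.im| < -(P i).1.re :=
    hPim.eventually_lt hPre.neg (by linarith)
  have ev3 : ∀ᶠ i in L, ‖e i‖ < ‖(P i).1‖ / 8 :=
    he.norm.eventually_lt (hP1.norm.div_const 8) (by rw [norm_zero]; positivity)
  have hT : Tendsto (fun i => coordT (e i) (P i).1) L (𝓝 (-1 / p.1)) := by
    have h1 : Tendsto (fun i => -1 / (P i).1) L (𝓝 (-1 / p.1)) := tendsto_const_nhds.div hP1 hx
    have h2 : Tendsto (fun i => coordT (e i) (P i).1 - -1 / (P i).1) L (𝓝 0) := by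
      apply squeeze_zero_norm' (a := fun i => ‖e i‖ / ‖(P i).1‖ ^ 2)
      · filter_upwards [ev1, ev2, ev3, hc] with i a1 a2 a3 a4
        exact (coordT_spec a1 a2.le a4 a3.le).2
      · have h3 : Tendsto (fun i => ‖e i‖ / ‖(P i).1‖ ^ 2) L (𝓝 (‖(0 : ℂ)‖ / ‖p.1‖ ^ 2)) :=
          he.norm.div (hP1.norm.pow 2) (by positivity)
        rwa [norm_zero, zero_div] at h3
    simpa using h2.add h1
  have hsq : p.1 ^ 2 + (0 : ℂ) ^ 2 ∈ Complex.slitPlane := by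
    left
    have : (p.1 ^ 2 + (0 : ℂ) ^ 2).re = p.1.re * p.1.re - p.1.im * p.1.im := by
      simp [sq, Complex.mul_re]
    rw [this]
    have := abs_le.mp him
    nlinarith
  have hL : Tendsto (fun i => Complex.log ((P i).1 ^ 2 + e i ^ 2)) L
      (𝓝 (Complex.log (p.1 ^ 2 + 0 ^ 2))) := ((hP1.pow 2).add (he.pow 2)).clog hsq
  rw [wI_eq_coordT q hre, coordT, if_pos rfl]
  refine (hT.sub (hL.const_mul (q / 2))).congr' ?_
  filter_upwards [ev1] with i hi
  rw [wI_eq_coordT q hi]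

/-- A family satisfying the step estimates and jointly continuous near the origin. -/
structure Tame (ρ : ℝ) (q r : ℂ) (F : ℂ → ℂ × ℂ → ℂ × ℂ) (C δ : ℝ) : Prop
    extends StepBound ρ q r F C δ where
  cont : ∀ p : ℂ × ℂ, ‖p.1‖ < δ → ‖p.2‖ < δ →
    ContinuousAt (fun t : ℂ × ℂ × ℂ => F t.1 t.2) (0, p)

theorem start_zero (hδ : 0 < δ) (hp : p ∈ bigSector ρ C δ) (m : ℕ) :
    ∃ T₀, Start (orbitTau δ) (orbitSigma ρ C) 0 p m T₀ ∧ T₀.re ≤ 2 / ‖p.1‖ :=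
  exists_start hδ hp (by rw [norm_zero]; positivity) (by simp) (by rw [norm_zero]; norm_num)

theorem Tame.small_zero (hF : Tame ρ q r F C δ) (hρ : 1 ≤ ρ) (hp : p ∈ bigSector ρ C δ) (j : ℕ) :
    ‖((F 0)^[j] p).1‖ < δ ∧ ‖((F 0)^[j] p).2‖ < δ := by
  obtain ⟨T₀, hS, -⟩ := start_zero hF.pos hp j
  obtain ⟨T, hI⟩ := hS.exists_inv hF.toStepBound hρ j le_rfl
  obtain ⟨h1, h2, -⟩ := hI.small hF.toStepBound hρ hS le_rfl
  exact ⟨h1, h2⟩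

theorem Tame.tendsto_iterate (hF : Tame ρ q r F C δ) (hρ : 1 ≤ ρ) (hp : p ∈ bigSector ρ C δ)
    (he : Tendsto e L (𝓝 0)) (hP : Tendsto P L (𝓝 p)) (N : ℕ) :
    Tendsto (fun i => (F (e i))^[N] (P i)) L (𝓝 ((F 0)^[N] p)) := by
  induction N with
  | zero => simpa using hP
  | succ N ih =>
    simp only [Function.iterate_succ_apply']
    obtain ⟨h1, h2⟩ := hF.small_zero hρ hp N
    exact (hF.cont _ h1 h2).tendsto.comp (he.prodMk_nhds ih)

/-- The general filter lets parameter and point vary together; a constant parameter `0` gives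
continuity in the point. -/
theorem Tame.tendsto_phi (hF : Tame ρ q r F C δ) (hρ : 1 ≤ ρ) (hp : p ∈ bigSector ρ C δ)
    (he : Tendsto e L (𝓝 0)) (hc : ∀ᶠ i in L, |(e i).im| ≤ (e i).re / 100)
    (hP : Tendsto P L (𝓝 p)) (N : ℕ) :
    Tendsto (fun i => phi q F (e i) N (P i)) L (𝓝 (phi q F 0 N p)) := by
  obtain ⟨T₀, hS, -⟩ := start_zero hF.pos hp N
  obtain ⟨T, hI⟩ := hS.exists_inv hF.toStepBound hρ N le_rfl
  obtain ⟨h1, h2⟩ := (hS.region (one_le_orbitTau hF.pos) le_rfl hI.near).1.re_neg_of_zero hI.rel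
  exact (tendsto_wI q he hc (hF.tendsto_iterate hρ hp he hP N) h1 (by linarith)).sub_const _

end Limits

/-! ### The incoming Fatou coordinate and sequences of bounded type -/

theorem Tame.dist_phi_zero_succ_le (hF : Tame ρ q r F C δ) (hρ : 1 < ρ) {p : ℂ × ℂ}
    (hp : p ∈ bigSector ρ C δ) {Λ : ℝ} (hΛ : 2 / ‖p.1‖ ≤ Λ) (n : ℕ) :
    dist (phi q F 0 n p) (phi q F 0 (n + 1) p) ≤ stepErr ρ q r C Λ n := by
  obtain ⟨T₀, hS, h⟩ := start_zero hF.pos hp (n + 1)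
  exact hS.dist_phi_succ_le hF.toStepBound hρ.le (Nat.lt_succ_self n) (h.trans hΛ)

theorem Tame.tendsto_fatouIn (hF : Tame ρ q r F C δ) (hρ : 1 < ρ) {p : ℂ × ℂ}
    (hp : p ∈ bigSector ρ C δ) :
    Tendsto (fun n => phiIn0 q F n p) atTop (𝓝 (fatouIn q F p)) := by
  have h1 : CauchySeq fun n => phi q F 0 n p :=
    cauchySeq_of_dist_le_of_summable _ (fun n => hF.dist_phi_zero_succ_le hρ hp le_rfl n)
      (summable_stepErr hρ _)
  simp only [phi_zero_eq] at h1
  exact h1.tendsto_limUnder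

theorem Tame.dist_fatouIn_le (hF : Tame ρ q r F C δ) (hρ : 1 < ρ) {p : ℂ × ℂ}
    (hp : p ∈ bigSector ρ C δ) {Λ : ℝ} (hΛ : 2 / ‖p.1‖ ≤ Λ) (n : ℕ) :
    dist (phi q F 0 n p) (fatouIn q F p) ≤ ∑' k, stepErr ρ q r C Λ (k + n) := by
  have h := hF.tendsto_fatouIn hρ hp
  simp only [← phi_zero_eq] at h
  have := dist_le_tsum_of_dist_le_of_tendsto _ (fun n => hF.dist_phi_zero_succ_le hρ hp hΛ n)
    (summable_stepErr hρ Λ) h n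
  simpa only [add_comm n] using this

/-- Multiplying the bounded difference by `ε → 0` gives `ε m → π/2`. All three claims follow by
taking real part, imaginary part and norm; `1.6` lies just above `π/2`. -/
theorem BoundedType.eventually {ε : ℕ → ℂ} {m : ℕ → ℕ} (h : BoundedType ε m) :
    (∀ᶠ ν in atTop, |(ε ν).im| ≤ (ε ν).re / 100) ∧ (∀ᶠ ν in atTop, ‖ε ν‖ * m ν ≤ 1.6) ∧
      ∀ N : ℕ, ∀ᶠ ν in atTop, N ≤ m ν := by
  obtain ⟨h0, h1, B, hB⟩ := h
  have hpi := Real.pi_gt_three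
  have hpi' := Real.pi_lt_d2
  have hlim : Tendsto (fun ν => ε ν * m ν) atTop (𝓝 ((Real.pi / 2 : ℝ) : ℂ)) := by
    have h2 : Tendsto (fun ν => ε ν * (Real.pi / (2 * ε ν) - m ν)) atTop (𝓝 0) := by
      apply squeeze_zero_norm (a := fun ν => ‖ε ν‖ * B)
      · intro ν; rw [norm_mul]; exact mul_le_mul_of_nonneg_left (hB ν) (norm_nonneg _)
      · simpa using h1.norm.mul_const B
    have h3 := (tendsto_const_nhds (x := ((Real.pi / 2 : ℝ) : ℂ))).sub h2
    rw [sub_zero] at h3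
    refine h3.congr fun ν => ?_
    have := h0 ν
    push_cast
    field_simp
    ring
  have hre : Tendsto (fun ν => (ε ν).re * m ν) atTop (𝓝 (Real.pi / 2)) := by
    have := (Complex.continuous_re.tendsto _).comp hlim
    simpa [Function.comp_def] using this
  have him : Tendsto (fun ν => (ε ν).im * m ν) atTop (𝓝 0) := by
    have := (Complex.continuous_im.tendsto _).comp hlim
    simpa [Function.comp_def, -Complex.ofReal_div] using this
  have hn : Tendsto (fun ν => ‖ε ν‖ * m ν) atTop (𝓝 (Real.pi / 2)) := by
    have := hlim.norm
    simpa [abs_of_pos Real.pi_pos, -Complex.ofReal_div] using this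
  refine ⟨?_, hn.eventually_le_const (by linarith), fun N => ?_⟩
  · have a1 := him.abs.eventually_lt (hre.div_const 100) (by rw [abs_zero]; positivity)
    filter_upwards [a1] with ν b1
    have hm : (0 : ℝ) ≤ m ν := Nat.cast_nonneg _
    rw [abs_mul, abs_of_nonneg hm] at b1
    have hm' : (0 : ℝ) < m ν := by
      rcases hm.lt_or_eq with h | h
      · exact h
      · rw [← h] at b1; simp at b1
    have : |(ε ν).im| * m ν ≤ (ε ν).re / 100 * m ν := by linarith
    exact le_of_mul_le_mul_right this hm'
  · have h4 : Tendsto (fun ν => ‖ε ν‖ * N) atTop (𝓝 0) := by simpa using h1.norm.mul_const (N : ℝ)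
    filter_upwards [h4.eventually_lt hn (by positivity)] with ν hν
    by_contra hlt
    have : (m ν : ℝ) ≤ N := by exact_mod_cast (not_le.mp hlt).le
    nlinarith [norm_nonneg (ε ν)]

/-- The budget closes since `1.6 · 201/200 + 1/2000 < 9/5`. Near `p` the bound `4/|p.1|` serves as a
common `Λ`. -/
theorem Tame.eventually_start (hF : Tame ρ q r F C δ) {p : ℂ × ℂ}
    (hp : p ∈ bigSector ρ C δ) {ε : ℕ → ℂ} {m : ℕ → ℕ} (h : BoundedType ε m) :
    ∀ᶠ z : ℕ × (ℂ × ℂ) in atTop ×ˢ 𝓝[bigSector ρ C δ] p, z.2 ∈ bigSector ρ C δ ∧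
      2 / ‖z.2.1‖ ≤ 4 / ‖p.1‖ ∧
      ∃ T₀, Start (orbitTau δ) (orbitSigma ρ C) (ε z.1) z.2 (m z.1) T₀ ∧ T₀.re ≤ 4 / ‖p.1‖ := by
  obtain ⟨h1, h2, -⟩ := h.eventually
  have hx : 0 < ‖p.1‖ := norm_pos_iff.mpr hp.1
  have e1 : ∀ᶠ z in 𝓝[bigSector ρ C δ] p, z ∈ bigSector ρ C δ := self_mem_nhdsWithin
  have e2 : ∀ᶠ z in 𝓝[bigSector ρ C δ] p, ‖p.1‖ / 2 < ‖z.1‖ := by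
    apply eventually_nhdsWithin_of_eventually_nhds
    exact (continuous_fst.norm.tendsto p).eventually_const_lt (by linarith)
  have e3 : ∀ᶠ ν in atTop, ‖ε ν‖ < ‖p.1‖ / 8000 := by
    have := h.2.1.norm
    rw [norm_zero] at this
    exact this.eventually_lt_const (by positivity)
  filter_upwards [(h1.and (h2.and e3)).prod_mk (e1.and e2)] with ⟨ν, z⟩ ⟨⟨a1, a2, a3⟩, a4, a5⟩
  simp only at *
  have hz : 0 < ‖z.1‖ := by linarith
  have hz2 : 2 / ‖z.1‖ ≤ 4 / ‖p.1‖ := by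
    rw [div_le_div_iff₀ hz hx]; linarith
  refine ⟨a4, hz2, ?_⟩
  have hm : ‖ε ν‖ * (2 / ‖z.1‖ + 201 / 200 * m ν) ≤ 9 / 5 := by
    have : ‖ε ν‖ * (2 / ‖z.1‖) ≤ (‖p.1‖ / 8000) * (4 / ‖p.1‖) := by gcongr
    have e : (‖p.1‖ / 8000) * (4 / ‖p.1‖) = 1 / 2000 := by field_simp; norm_num
    rw [mul_add]
    linarith
  obtain ⟨T₀, b1, b2⟩ := exists_start hF.pos a4 (by linarith) a1 hm
  exact ⟨T₀, b1, b2.trans hz2⟩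

theorem Tame.tendstoLocallyUniformlyOn_phiIn0 (hF : Tame ρ q r F C δ) (hρ : 1 < ρ) :
    TendstoLocallyUniformlyOn (phiIn0 q F) (fatouIn q F) atTop (bigSector ρ C δ) := by
  rw [Metric.tendstoLocallyUniformlyOn_iff]
  intro η hη p hp
  have hx : 0 < ‖p.1‖ := norm_pos_iff.mpr hp.1
  refine ⟨{z | z ∈ bigSector ρ C δ ∧ ‖p.1‖ / 2 < ‖z.1‖}, ?_, ?_⟩
  · refine Filter.inter_mem self_mem_nhdsWithin (mem_nhdsWithin_of_mem_nhds ?_)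
    exact (continuous_fst.norm.tendsto p).eventually_const_lt (by linarith)
  · have ht := tendsto_sum_nat_add (stepErr ρ q r C (4 / ‖p.1‖))
    filter_upwards [ht.eventually_lt_const hη] with n hn z hz
    rw [dist_comm, ← phi_zero_eq]
    refine (hF.dist_fatouIn_le hρ hz.1 ?_ n).trans_lt hn
    rw [div_le_div_iff₀ (by linarith [hz.2]) hx]; linarith [hz.2]

/-- Four errors of size `η/4`: the tail beyond `N` for `ε`, the tail for `0`, and the distances of
both `N`-th coordinates at the moving point from the one at `p`. -/
theorem Tame.tendstoLocallyUniformlyOn_phiIn (hF : Tame ρ q r F C δ) (hρ : 1 < ρ) {ε : ℕ → ℂ}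
    {m : ℕ → ℕ} (h : BoundedType ε m) :
    TendstoLocallyUniformlyOn (fun ν => phiIn q F (ε ν) (m ν)) (fatouIn q F) atTop
      (bigSector ρ C δ) := by
  rw [tendstoLocallyUniformlyOn_iff_forall_tendsto]
  intro p hp
  rw [Metric.uniformity_basis_dist.tendsto_right_iff]
  intro η hη
  have ht := tendsto_sum_nat_add (stepErr ρ q r C (4 / ‖p.1‖))
  obtain ⟨N, hN⟩ := (ht.eventually_lt_const (show 0 < η / 4 by linarith)).exists
  obtain ⟨h1, -, h3⟩ := h.eventually
  have hP : Tendsto (fun z : ℕ × (ℂ × ℂ) => z.2) (atTop ×ˢ 𝓝[bigSector ρ C δ] p) (𝓝 p) :=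
    tendsto_snd.mono_right nhdsWithin_le_nhds
  have k1 := hF.tendsto_phi hρ.le hp (h.2.1.comp tendsto_fst)
    (tendsto_fst.eventually h1) hP N
  have k2 := hF.tendsto_phi hρ.le hp (e := fun _ : ℕ × (ℂ × ℂ) => (0 : ℂ)) tendsto_const_nhds
    (Eventually.of_forall fun _ => by simp) hP N
  filter_upwards [hF.eventually_start hp h, tendsto_fst.eventually (h3 N),
    (Metric.tendsto_nhds.mp k1) (η / 4) (by linarith),
    (Metric.tendsto_nhds.mp k2) (η / 4) (by linarith)] with ⟨ν, z⟩ ⟨a1, a2, T₀, a3, a4⟩ a5 a6 a7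
  simp only [Function.comp_apply] at *
  rw [← phi_eq (h.1 ν), dist_comm]
  have b1 := a3.dist_phi_le_tsum hF.toStepBound hρ a5 a4
  have b2 := hF.dist_fatouIn_le hρ a1 a2 N
  have d1 := dist_triangle (phi q F (ε ν) (m ν) z) (phi q F (ε ν) N z) (fatouIn q F z)
  have d2 := dist_triangle (phi q F (ε ν) N z) (phi q F 0 N p) (fatouIn q F z)
  have d3 := dist_triangle (phi q F 0 N p) (phi q F 0 N z) (fatouIn q F z)
  rw [dist_comm (phi q F (ε ν) (m ν) z) (phi q F (ε ν) N z)] at d1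
  rw [dist_comm (phi q F 0 N p) (phi q F 0 N z)] at d3
  linarith

/-- Meant for the inverse family: smallness shows that backward iterates are defined, and avoiding
the branch cut makes `u` odd at the final point. -/
theorem Tame.eventually_small (hF : Tame ρ q r F C δ) (hρ : 1 < ρ) {p : ℂ × ℂ}
    (hp : p ∈ bigSector ρ C δ) {ε : ℕ → ℂ} {m : ℕ → ℕ} (h : BoundedType ε m) :
    ∀ᶠ z : ℕ × (ℂ × ℂ) in atTop ×ˢ 𝓝[bigSector ρ C δ] p,
      (∀ j ≤ m z.1, ‖((F (ε z.1))^[j] z.2).1‖ < δ ∧ ‖((F (ε z.1))^[j] z.2).2‖ < δ) ∧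
      (Complex.I * ε z.1 - ((F (ε z.1))^[m z.1] z.2).1) /
        (Complex.I * ε z.1 + ((F (ε z.1))^[m z.1] z.2).1) ∈ Complex.slitPlane := by
  filter_upwards [hF.eventually_start hp h] with ⟨ν, z⟩ ⟨a1, a2, T₀, a3, a4⟩
  constructor
  · intro j hj
    obtain ⟨T, hI⟩ := a3.exists_inv hF.toStepBound hρ.le j hj
    obtain ⟨h1, h2, -⟩ := hI.small hF.toStepBound hρ.le a3 hj
    exact ⟨h1, h2⟩
  · obtain ⟨T, hI⟩ := a3.exists_inv hF.toStepBound hρ.le (m ν) le_rfl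
    exact (principal_log (a3.region (one_le_orbitTau hF.pos) le_rfl hI.near).1 hI.rel (h.1 ν)).1

/-! ### From germs to quantitative estimates -/

theorem IsOTwo.exists_bound {g : ℂ × ℂ × ℂ → ℂ} (h : IsOTwo g) :
    ∃ C, 0 ≤ C ∧ ∀ᶠ t : ℂ × ℂ × ℂ in 𝓝 0,
      ‖g t‖ ≤ C * (‖t.2.1‖ ^ 2 + ‖t.2.2‖ ^ 2 + ‖t.1‖ ^ 2) := by
  obtain ⟨a, b, c, d, ha, hb, hc, hd, h⟩ := h
  have key : ∀ f : ℂ × ℂ × ℂ → ℂ, AnalyticAt ℂ f 0 → ∀ᶠ t in 𝓝 0, ‖f t‖ < ‖f 0‖ + 1 := fun f hf =>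
    hf.continuousAt.norm.eventually_lt_const (by linarith)
  set M := (‖a 0‖ + 1) + (‖b 0‖ + 1) + (‖c 0‖ + 1) + (‖d 0‖ + 1) with hM
  refine ⟨M, by positivity, ?_⟩
  filter_upwards [h, key a ha, key b hb, key c hc, key d hd] with t h a1 a2 a3 a4
  rw [h]
  have hx := norm_nonneg t.2.1
  have hy := norm_nonneg t.2.2
  set Q := ‖t.2.1‖ ^ 2 + ‖t.2.2‖ ^ 2 + ‖t.1‖ ^ 2 with hQ
  have hQ0 : 0 ≤ Q := by positivity
  have h1 : ‖t.2.1 ^ 2 * a t‖ ≤ Q * (‖a 0‖ + 1) := by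
    rw [norm_mul, norm_pow]; gcongr; rw [hQ]; nlinarith [sq_nonneg ‖t.2.2‖, sq_nonneg ‖t.1‖]
  have h2 : ‖t.2.1 * t.2.2 * b t‖ ≤ Q * (‖b 0‖ + 1) := by
    rw [norm_mul, norm_mul]; gcongr
    rw [hQ]; nlinarith [sq_nonneg (‖t.2.1‖ - ‖t.2.2‖), sq_nonneg ‖t.1‖]
  have h3 : ‖t.2.2 ^ 2 * c t‖ ≤ Q * (‖c 0‖ + 1) := by
    rw [norm_mul, norm_pow]; gcongr; rw [hQ]; nlinarith [sq_nonneg ‖t.2.1‖, sq_nonneg ‖t.1‖]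
  have h4 : ‖t.1 ^ 2 * d t‖ ≤ Q * (‖d 0‖ + 1) := by
    rw [norm_mul, norm_pow]; gcongr; rw [hQ]; nlinarith [sq_nonneg ‖t.2.1‖, sq_nonneg ‖t.2.2‖]
  refine (norm_add_le _ _).trans ?_
  have h5 := norm_add₃_le (a := t.2.1 ^ 2 * a t) (b := t.2.1 * t.2.2 * b t) (c := t.2.2 ^ 2 * c t)
  rw [hM]
  linarith

theorem IsOTwo.analyticAt {g : ℂ × ℂ × ℂ → ℂ} (h : IsOTwo g) : AnalyticAt ℂ g 0 ∧ g 0 = 0 := by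
  obtain ⟨a, b, c, d, ha, hb, hc, hd, h⟩ := h
  constructor
  · have h1 : AnalyticAt ℂ (fun t : ℂ × ℂ × ℂ => t.1) 0 := analyticAt_fst
    have h2 : AnalyticAt ℂ (fun t : ℂ × ℂ × ℂ => t.2.1) 0 := analyticAt_fst.comp analyticAt_snd
    have h3 : AnalyticAt ℂ (fun t : ℂ × ℂ × ℂ => t.2.2) 0 := analyticAt_snd.comp analyticAt_snd
    have := ((((h2.pow 2).mul ha).add ((h2.mul h3).mul hb)).add ((h3.pow 2).mul hc)).add
      ((h1.pow 2).mul hd)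
    exact this.congr (h.mono fun t ht => ht.symm)
  · rw [h.self_of_nhds]; simp

theorem exists_ball {P : ℂ → ℂ × ℂ → Prop} (h : ∀ᶠ t : ℂ × ℂ × ℂ in 𝓝 0, P t.1 t.2) :
    ∃ δ > 0, ∀ ε p, ‖ε‖ < δ → ‖p.1‖ < δ → ‖p.2‖ < δ → P ε p := by
  obtain ⟨δ, hδ, h⟩ := Metric.eventually_nhds_iff_ball.mp h
  refine ⟨δ, hδ, fun ε p h1 h2 h3 => h (ε, p) ?_⟩
  rw [mem_ball_zero_iff, Prod.norm_mk, Prod.norm_def]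
  exact max_lt h1 (max_lt h2 h3)

theorem exists_quadForm_of_eventually (hC : 0 ≤ C)
    (h : ∀ᶠ t : ℂ × ℂ × ℂ in 𝓝 0, ∃ a b : ℂ,
      F t.1 t.2 = (t.2.1 + (t.2.1 ^ 2 + t.1 ^ 2) * a, t.2.2 * (1 + ρ * t.2.1 + b)) ∧
      ‖a - (1 + (q + 1) * t.2.1 + r * t.2.2)‖ ≤ C * (‖t.2.1‖ ^ 2 + ‖t.2.2‖ ^ 2 + ‖t.1‖ ^ 2) ∧
      ‖b‖ ≤ C * (‖t.2.1‖ ^ 2 + ‖t.2.2‖ ^ 2 + ‖t.1‖ ^ 2)) :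
    ∃ δ, QuadForm ρ q r F C δ := by
  obtain ⟨δ, hδ, h⟩ := exists_ball (P := fun ε p => ∃ a b : ℂ,
      F ε p = (p.1 + (p.1 ^ 2 + ε ^ 2) * a, p.2 * (1 + ρ * p.1 + b)) ∧
      ‖a - (1 + (q + 1) * p.1 + r * p.2)‖ ≤ C * (‖p.1‖ ^ 2 + ‖p.2‖ ^ 2 + ‖ε‖ ^ 2) ∧
      ‖b‖ ≤ C * (‖p.1‖ ^ 2 + ‖p.2‖ ^ 2 + ‖ε‖ ^ 2)) h
  exact ⟨δ, hC, hδ, fun ε x y h1 h2 h3 => h ε (x, y) h1 h2 h3⟩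

theorem HasForm.exists_quadForm (h : HasForm ρ q r F) : ∃ C δ, QuadForm ρ q r F C δ := by
  obtain ⟨α, β, hα, hβ, h⟩ := h
  obtain ⟨C₁, hC₁, h₁⟩ := hα.exists_bound
  obtain ⟨C₂, hC₂, h₂⟩ := hβ.exists_bound
  refine ⟨C₁ + C₂, exists_quadForm_of_eventually (by positivity) ?_⟩
  filter_upwards [h, h₁, h₂] with t a1 a2 a3
  refine ⟨α t, β t, a1, a2.trans ?_, a3.trans ?_⟩ <;> gcongr <;> linarith

/-- All corrections to `(ε, p) ↦ (ε, p)` vanish to second order, so the derivative at the origin is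
the identity and the inverse function theorem applies jointly in `ε` and `p`. -/
theorem HasForm.analyticAt (h : HasForm ρ q r F) :
    AnalyticAt ℂ (fun t : ℂ × ℂ × ℂ => F t.1 t.2) 0 ∧
      HasStrictFDerivAt (fun t : ℂ × ℂ × ℂ => (t.1, F t.1 t.2))
        (ContinuousLinearMap.id ℂ (ℂ × ℂ × ℂ)) 0 ∧ F 0 0 = 0 := by
  obtain ⟨α, β, hα, hβ, h⟩ := h
  have h1 : AnalyticAt ℂ (fun t : ℂ × ℂ × ℂ => t.1) 0 := analyticAt_fst
  have h2 : AnalyticAt ℂ (fun t : ℂ × ℂ × ℂ => t.2.1) 0 := analyticAt_fst.comp analyticAt_snd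
  have h3 : AnalyticAt ℂ (fun t : ℂ × ℂ × ℂ => t.2.2) 0 := analyticAt_snd.comp analyticAt_snd
  have hα' : AnalyticAt ℂ α 0 := by
    have := hα.analyticAt.1.add ((analyticAt_const (v := (1 : ℂ)).add
      ((analyticAt_const (v := q + 1)).mul h2)).add ((analyticAt_const (v := r)).mul h3))
    refine this.congr (Eventually.of_forall fun t => ?_)
    simp
  have hβ' := hβ.analyticAt.1
  have hx : AnalyticAt ℂ (fun t : ℂ × ℂ × ℂ => t.2.1 + (t.2.1 ^ 2 + t.1 ^ 2) * α t) 0 :=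
    h2.add (((h2.pow 2).add (h1.pow 2)).mul hα')
  have hy : AnalyticAt ℂ (fun t : ℂ × ℂ × ℂ => t.2.2 * (1 + ρ * t.2.1 + β t)) 0 :=
    h3.mul ((analyticAt_const.add (analyticAt_const.mul h2)).add hβ')
  have d1 : HasStrictFDerivAt (fun t : ℂ × ℂ × ℂ => t.1) (ContinuousLinearMap.fst ℂ ℂ (ℂ × ℂ)) 0 :=
    hasStrictFDerivAt_fst
  have d2 : HasStrictFDerivAt (fun t : ℂ × ℂ × ℂ => t.2.1)
      ((ContinuousLinearMap.fst ℂ ℂ ℂ).comp (ContinuousLinearMap.snd ℂ ℂ (ℂ × ℂ))) 0 :=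
    hasStrictFDerivAt_fst.comp 0 hasStrictFDerivAt_snd
  have d3 : HasStrictFDerivAt (fun t : ℂ × ℂ × ℂ => t.2.2)
      ((ContinuousLinearMap.snd ℂ ℂ ℂ).comp (ContinuousLinearMap.snd ℂ ℂ (ℂ × ℂ))) 0 :=
    hasStrictFDerivAt_snd.comp 0 hasStrictFDerivAt_snd
  refine ⟨(hx.prod hy).congr (h.mono fun t ht => ht.symm), ?_, ?_⟩
  · have e1 := d2.add (((d2.mul d2).add (d1.mul d1)).mul hα'.hasStrictFDerivAt)
    have e2 := d3.mul (((h2.const_smul (c := (ρ : ℂ))).add hβ').hasStrictFDerivAt.const_add 1)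
    have e3 := d1.prodMk (e1.prodMk e2)
    refine (e3.congr_fderiv ?_).congr_of_eventuallyEq ?_
    · ext <;> simp [hβ.analyticAt.2]
    · filter_upwards [h] with t ht
      rw [ht]
      simp [sq, add_assoc]
  · have h0 : F 0 0 = (0, 0) := by simpa using h.self_of_nhds
    exact h0

/-! ### The inverse family -/

/-- The inverse family, conjugated by `p ↦ -p`. -/
noncomputable def negInv (F : ℂ → ℂ × ℂ → ℂ × ℂ) (U : Set (ℂ × ℂ)) (ε : ℂ) (p : ℂ × ℂ) : ℂ × ℂ :=
  -invBranch (F ε) U (-p)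

theorem invBranch_iterate (F : ℂ → ℂ × ℂ → ℂ × ℂ) (U : Set (ℂ × ℂ)) (ε : ℂ) (n : ℕ) (p : ℂ × ℂ) :
    (invBranch (F ε) U)^[n] p = -(negInv F U ε)^[n] (-p) := by
  induction n with
  | zero => simp
  | succ n ih =>
    rw [Function.iterate_succ_apply', Function.iterate_succ_apply', ih]
    simp [negInv]

/-- Near the origin the inverse branch is a continuous right inverse with values close to the
origin. -/
theorem HasForm.exists_inverse (h : HasForm ρ q r F) {U : Set (ℂ × ℂ)} (hU : U ∈ 𝓝 (0 : ℂ × ℂ))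
    (hinj : ∀ᶠ ε in 𝓝 (0 : ℂ), Set.InjOn (F ε) U) :
    Tendsto (fun t : ℂ × ℂ × ℂ => invBranch (F t.1) U t.2) (𝓝 0) (𝓝 0) ∧
      ∀ᶠ t : ℂ × ℂ × ℂ in 𝓝 0, F t.1 (invBranch (F t.1) U t.2) = t.2 ∧ t.2 ∈ F t.1 '' U ∧
        ContinuousAt (fun t : ℂ × ℂ × ℂ => invBranch (F t.1) U t.2) t := by
  obtain ⟨-, h1, h0⟩ := h.analyticAt
  have h1' : HasStrictFDerivAt (fun t : ℂ × ℂ × ℂ => (t.1, F t.1 t.2))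
      ((ContinuousLinearEquiv.refl ℂ (ℂ × ℂ × ℂ) : (ℂ × ℂ × ℂ) ≃L[ℂ] (ℂ × ℂ × ℂ)) :
        (ℂ × ℂ × ℂ) →L[ℂ] (ℂ × ℂ × ℂ)) 0 := h1
  set Φ := h1'.toOpenPartialHomeomorph with hΦ
  have hcoe : ∀ t : ℂ × ℂ × ℂ, Φ t = (t.1, F t.1 t.2) := fun t => rfl
  have h00 : Φ 0 = 0 := by
    rw [hcoe]; exact Prod.ext rfl h0
  have htgt : (0 : ℂ × ℂ × ℂ) ∈ Φ.target := by
    have := h1'.image_mem_toOpenPartialHomeomorph_target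
    rwa [show ((0 : ℂ × ℂ × ℂ).1, F (0 : ℂ × ℂ × ℂ).1 (0 : ℂ × ℂ × ℂ).2) = (0 : ℂ × ℂ × ℂ) from
      Prod.ext rfl h0] at this
  have hsymm0 : Φ.symm 0 = 0 := by
    have := Φ.left_inv h1'.mem_toOpenPartialHomeomorph_source
    rwa [h00] at this
  have hcont : Tendsto Φ.symm (𝓝 0) (𝓝 0) := by
    have := Φ.continuousAt_symm htgt
    rwa [ContinuousAt, hsymm0] at this
  have hev : ∀ᶠ t : ℂ × ℂ × ℂ in 𝓝 0, t ∈ Φ.target ∧ F t.1 (Φ.symm t).2 = t.2 ∧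
      (Φ.symm t).2 ∈ U ∧ invBranch (F t.1) U t.2 = (Φ.symm t).2 := by
    have e1 : ∀ᶠ t in 𝓝 (0 : ℂ × ℂ × ℂ), t ∈ Φ.target := Φ.open_target.mem_nhds htgt
    have e2 : ∀ᶠ t in 𝓝 (0 : ℂ × ℂ × ℂ), (Φ.symm t).2 ∈ U := by
      have : Tendsto (fun t => (Φ.symm t).2) (𝓝 0) (𝓝 (0 : ℂ × ℂ × ℂ).2) :=
        (continuous_snd.tendsto _).comp hcont
      exact this.eventually hU
    have e3 : ∀ᶠ t : ℂ × ℂ × ℂ in 𝓝 0, Set.InjOn (F t.1) U :=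
      (continuous_fst.tendsto (0 : ℂ × ℂ × ℂ)).eventually hinj
    filter_upwards [e1, e2, e3] with t a1 a2 a3
    have a4 := Φ.right_inv a1
    rw [hcoe] at a4
    obtain ⟨a5, a6⟩ := Prod.ext_iff.mp a4
    simp only at a5 a6
    rw [a5] at a6
    refine ⟨a1, a6, a2, ?_⟩
    -- Injectivity on `U` identifies the chosen inverse branch with the local inverse.
    have := a3.leftInvOn_invFunOn a2
    rwa [a6] at this
  constructor
  · have : Tendsto (fun t => (Φ.symm t).2) (𝓝 0) (𝓝 (0 : ℂ × ℂ)) :=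
      (continuous_snd.tendsto (0 : ℂ × ℂ × ℂ)).comp hcont
    exact this.congr' (hev.mono fun t ht => ht.2.2.2.symm)
  · filter_upwards [hev.eventually_nhds] with t ht
    obtain ⟨b1, b2, b3, b4⟩ := ht.self_of_nhds
    refine ⟨by rw [b4, b2], ⟨_, b3, b2⟩, ?_⟩
    have : ContinuousAt (fun t => (Φ.symm t).2) t := (Φ.continuousAt_symm b1).snd
    exact this.congr (ht.mono fun s hs => hs.2.2.2.symm)

set_option maxHeartbeats 1000000 in
/-- The inverse of a map of the form under consideration has the same form, with `q` replaced by
`-q` and `r` by `-r` after conjugation by `p ↦ -p`. -/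
theorem inverse_form {K : ℝ} {ε x y x' y' a b : ℂ}
    (hK : 1 + ‖q‖ + ‖r‖ + |ρ| + C = K) (hC : 0 ≤ C)
    (hs : (‖x‖ + ‖y‖ + ‖ε‖) * (100 * K) ≤ 1)
    (ex : x' = x + (x ^ 2 + ε ^ 2) * a) (ey : y' = y * (1 + ρ * x + b))
    (ha : ‖a - (1 + (q + 1) * x + r * y)‖ ≤ C * (‖x‖ ^ 2 + ‖y‖ ^ 2 + ‖ε‖ ^ 2))
    (hb : ‖b‖ ≤ C * (‖x‖ ^ 2 + ‖y‖ ^ 2 + ‖ε‖ ^ 2)) :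
    ∃ A B : ℂ, -x = -x' + ((-x') ^ 2 + ε ^ 2) * A ∧ -y = -y' * (1 + ρ * -x' + B) ∧
      ‖A - (1 + (-q + 1) * -x' + -r * -y')‖ ≤ 400 * K ^ 2 * (‖x'‖ ^ 2 + ‖y'‖ ^ 2 + ‖ε‖ ^ 2) ∧
      ‖B‖ ≤ 400 * K ^ 2 * (‖x'‖ ^ 2 + ‖y'‖ ^ 2 + ‖ε‖ ^ 2) := by
  have q0 := norm_nonneg q
  have r0 := norm_nonneg r
  have ρ0 := abs_nonneg ρ
  have x0 := norm_nonneg x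
  have y0 := norm_nonneg y
  have ε0 := norm_nonneg ε
  have K1 : 1 ≤ K := by linarith
  set Q := ‖x‖ ^ 2 + ‖y‖ ^ 2 + ‖ε‖ ^ 2 with hQ
  have Q0 : 0 ≤ Q := by positivity
  set s := ‖x‖ + ‖y‖ + ‖ε‖ with hs'
  have s0 : 0 ≤ s := by positivity
  have hKs : K * s ≤ 1 / 100 := by linarith
  have hsKs : s ≤ K * s := by nlinarith
  have hs1 : s ≤ 1 / 100 := by linarith
  have hQs : Q ≤ s ^ 2 := by
    rw [hQ, hs']; nlinarith [mul_nonneg x0 y0, mul_nonneg x0 ε0, mul_nonneg y0 ε0]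
  have hsQ : s ^ 2 ≤ 3 * Q := by
    rw [hQ, hs']; nlinarith [sq_nonneg (‖x‖ - ‖y‖), sq_nonneg (‖x‖ - ‖ε‖), sq_nonneg (‖y‖ - ‖ε‖)]
  have hss : s ^ 2 ≤ s := by nlinarith
  have hxs : ‖x‖ ≤ s := by linarith
  have hys : ‖y‖ ≤ s := by linarith
  have hKsQ : K * s ^ 2 ≤ 3 * (K * Q) := by
    calc K * s ^ 2 ≤ K * (3 * Q) := by gcongr
      _ = _ := by ring
  have hQK : Q ≤ K * Q := le_mul_of_one_le_left Q0 K1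
  have hKK : K * Q ≤ K ^ 2 * Q := by gcongr; nlinarith
  have ha1 : ‖a - 1‖ ≤ K * s := by
    have e1 : a - 1 = (a - (1 + (q + 1) * x + r * y)) + (q + 1) * x + r * y := by ring
    have hq1 : ‖q + 1‖ ≤ ‖q‖ + 1 := (norm_add_le _ _).trans (by rw [norm_one])
    rw [e1]
    refine (norm_add₃_le).trans ?_
    rw [norm_mul, norm_mul]
    calc _ ≤ C * s + (‖q‖ + 1) * s + ‖r‖ * s := by
          gcongr; exact ha.trans (by gcongr; linarith)
      _ = (K - |ρ|) * s := by rw [← hK]; ring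
      _ ≤ K * s := by gcongr; linarith
  have ha2 : ‖a‖ ≤ 2 := by
    have := norm_add_le (a - 1) 1
    rw [sub_add_cancel, norm_one] at this; linarith
  have hw : ‖x ^ 2 + ε ^ 2‖ ≤ Q := by
    refine (norm_add_le _ _).trans ?_
    rw [norm_pow, norm_pow, hQ]; nlinarith
  -- `E` is the factor in `x'² + ε² = (x² + ε²) E`, so that `x' - x = (x'² + ε²)(a / E)`. To first
  -- order `E = 1 + 2x`, which turns `q + 1` into `q - 1 = -((-q) + 1)`.
  set E := 1 + 2 * x * a + (x ^ 2 + ε ^ 2) * a ^ 2 with hE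
  have hE2 : ‖E - 1 - 2 * x‖ ≤ 10 * (K * Q) := by
    have e1 : E - 1 - 2 * x = 2 * (x * (a - 1)) + (x ^ 2 + ε ^ 2) * a ^ 2 := by rw [hE]; ring
    rw [e1]
    refine (norm_add_le _ _).trans ?_
    rw [norm_mul, norm_mul, norm_mul, norm_pow, Complex.norm_two]
    calc _ ≤ 2 * (s * (K * s)) + Q * 2 ^ 2 := by gcongr
      _ = 2 * (K * s ^ 2) + 4 * Q := by ring
      _ ≤ _ := by linarith
  have hE1 : ‖E - 1‖ ≤ 3 * s := by
    have e1 : E - 1 = (E - 1 - 2 * x) + 2 * x := by ring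
    rw [e1]
    refine (norm_add_le _ _).trans ?_
    rw [norm_mul, Complex.norm_two]
    have : K * Q ≤ K * s ^ 2 := by gcongr
    have : K * s ^ 2 = (K * s) * s := by ring
    have : (K * s) * s ≤ 1 / 100 * s := by gcongr
    linarith
  have half : ∀ z : ℂ, ‖z - 1‖ ≤ 1 / 2 → 1 / 2 ≤ ‖z‖ := by
    intro z hz
    have := norm_sub_norm_le (1 : ℂ) (1 - z)
    rw [sub_sub_cancel, norm_one, norm_sub_rev] at this
    linarith
  have hEn := half E (by linarith)
  have hE0 : E ≠ 0 := by intro h; rw [h, norm_zero] at hEn; linarith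
  have div2 : ∀ (z w : ℂ) (c : ℝ), 1 / 2 ≤ ‖w‖ → ‖z‖ ≤ c → ‖z / w‖ ≤ 2 * c := by
    intro z w c hw hz
    rw [norm_div, div_le_iff₀ (by linarith)]
    have h1 := mul_le_mul_of_nonneg_left hw ((norm_nonneg z).trans hz)
    linarith
  set D := 1 + ρ * x + b with hD
  have hρb : ‖(ρ * x + b : ℂ)‖ ≤ K * s := by
    refine (norm_add_le _ _).trans ?_
    rw [norm_mul, Complex.norm_real, Real.norm_eq_abs]
    calc _ ≤ |ρ| * s + C * s := by
          gcongr; exact hb.trans (by gcongr; linarith)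
      _ = (|ρ| + C) * s := by ring
      _ ≤ K * s := by gcongr; linarith
  have hDn := half D (by
    have e : D - 1 = ρ * x + b := by rw [hD]; ring
    rw [e]; linarith)
  have hD0 : D ≠ 0 := by intro h; rw [h, norm_zero] at hDn; linarith
  have hxx : ‖x' - x‖ ≤ 2 * Q := by
    have e : x' - x = (x ^ 2 + ε ^ 2) * a := by rw [ex]; ring
    rw [e, norm_mul]
    calc _ ≤ Q * 2 := by gcongr
      _ = _ := by ring
  have hyy : ‖y' - y‖ ≤ K * s * s := by
    have e : y' - y = (ρ * x + b) * y := by rw [ey]; ring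
    rw [e, norm_mul]
    gcongr
  -- Old and new variables have comparable size, so remainders quadratic in `(x, y, ε)` are
  -- quadratic in `(x', y', ε)`; hence `400 = 50 · 8`.
  have hQ' : Q ≤ 8 * (‖x'‖ ^ 2 + ‖y'‖ ^ 2 + ‖ε‖ ^ 2) := by
    have h1 : ‖x‖ ≤ 2 * ‖x'‖ + ‖ε‖ := by
      have e : x' - x = (x ^ 2 + ε ^ 2) * a := by rw [ex]; ring
      have h2 := norm_sub_norm_le x x'
      rw [norm_sub_rev, e, norm_mul] at h2
      have h3 : ‖x ^ 2 + ε ^ 2‖ ≤ ‖x‖ / 100 + ‖ε‖ / 100 := by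
        refine (norm_add_le _ _).trans ?_
        rw [norm_pow, norm_pow]
        gcongr <;> nlinarith
      have h4 : ‖x ^ 2 + ε ^ 2‖ * ‖a‖ ≤ (‖x‖ / 100 + ‖ε‖ / 100) * 2 := by gcongr
      linarith
    have h2 : ‖y‖ ≤ 2 * ‖y'‖ := by
      rw [ey, norm_mul]; nlinarith
    have h5 : ‖x‖ ^ 2 ≤ (2 * ‖x'‖ + ‖ε‖) ^ 2 := by gcongr
    have h6 : ‖y‖ ^ 2 ≤ (2 * ‖y'‖) ^ 2 := by gcongr
    rw [hQ]
    nlinarith [sq_nonneg (2 * ‖x'‖ - ‖ε‖), sq_nonneg ‖y'‖, sq_nonneg ‖ε‖]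
  have fin : ∀ z : ℂ, ‖z‖ ≤ 50 * (K ^ 2 * Q) →
      ‖z‖ ≤ 400 * K ^ 2 * (‖x'‖ ^ 2 + ‖y'‖ ^ 2 + ‖ε‖ ^ 2) := by
    intro z hz
    refine hz.trans ?_
    calc _ ≤ 50 * (K ^ 2 * (8 * (‖x'‖ ^ 2 + ‖y'‖ ^ 2 + ‖ε‖ ^ 2))) := by gcongr
      _ = _ := by ring
  refine ⟨a / E, 1 / D - 1 + ρ * x', ?_, ?_, fin _ ?_, fin _ ?_⟩
  · have e1 : (-x') ^ 2 + ε ^ 2 = (x ^ 2 + ε ^ 2) * E := by rw [ex, hE]; ring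
    rw [e1, ex]
    field_simp
    ring
  · rw [ey]
    have e1 : (1 : ℂ) + ρ * -x' + (1 / D - 1 + ρ * x') = 1 / D := by ring
    rw [e1]
    field_simp
  · set S := (q - 1) * x + r * y with hS
    have hSn : ‖S‖ ≤ K * s := by
      refine (norm_add_le _ _).trans ?_
      rw [norm_mul, norm_mul]
      have hq1 : ‖q - 1‖ ≤ ‖q‖ + 1 := (norm_sub_le _ _).trans (by rw [norm_one])
      calc _ ≤ (‖q‖ + 1) * s + ‖r‖ * s := by gcongr
        _ = (1 + ‖q‖ + ‖r‖) * s := by ring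
        _ ≤ K * s := by gcongr; linarith
    have e1 : a / E - (1 + (-q + 1) * -x' + -r * -y') =
        ((a - (1 + (q + 1) * x + r * y)) + -(E - 1 - 2 * x) + -(S * (E - 1))) / E +
          -((q - 1) * (x' - x)) + -(r * (y' - y)) := by
      rw [hS]; field_simp; ring
    rw [e1]
    refine norm_add₃_le.trans ?_
    rw [norm_neg, norm_neg, norm_mul, norm_mul]
    have h1 : ‖((a - (1 + (q + 1) * x + r * y)) + -(E - 1 - 2 * x) + -(S * (E - 1)))‖ ≤
        20 * (K * Q) := by
      refine norm_add₃_le.trans ?_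
      rw [norm_neg, norm_neg, norm_mul]
      have h2 : ‖S‖ * ‖E - 1‖ ≤ (K * s) * (3 * s) := by gcongr
      have h3 : (K * s) * (3 * s) = 3 * (K * s ^ 2) := by ring
      have h4 : C * Q ≤ K * Q := by gcongr; linarith
      linarith
    have h2 := div2 _ _ _ hEn h1
    have h3 : ‖q - 1‖ * ‖x' - x‖ ≤ K * (2 * Q) := by
      have hq1 : ‖q - 1‖ ≤ ‖q‖ + 1 := (norm_sub_le _ _).trans (by rw [norm_one])
      gcongr; linarith
    have h4 : ‖r‖ * ‖y' - y‖ ≤ 3 * (K ^ 2 * Q) := by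
      calc ‖r‖ * ‖y' - y‖ ≤ K * (K * s * s) := by gcongr; linarith
        _ = K * (K * s ^ 2) := by ring
        _ ≤ K * (3 * (K * Q)) := by gcongr
        _ = _ := by ring
    linarith
  · have e1 : 1 / D - 1 + ρ * x' = (-b + ρ * x * (ρ * x + b)) / D + ρ * (x' - x) := by
      rw [hD] at hD0 ⊢; field_simp; ring
    rw [e1]
    refine (norm_add_le _ _).trans ?_
    have h1 : ‖-b + ρ * x * (ρ * x + b)‖ ≤ 4 * (K ^ 2 * Q) := by
      refine (norm_add_le _ _).trans ?_
      rw [norm_neg, norm_mul, norm_mul, Complex.norm_real, Real.norm_eq_abs]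
      have h2 : |ρ| * ‖x‖ * ‖(ρ * x + b : ℂ)‖ ≤ K * s * (K * s) := by gcongr; linarith
      have h3 : K * s * (K * s) = K * (K * s ^ 2) := by ring
      have h4 : K * (K * s ^ 2) ≤ K * (3 * (K * Q)) := by gcongr
      have h5 : C * Q ≤ K * Q := by gcongr; linarith
      linarith
    have h2 := div2 _ _ _ hDn h1
    have h3 : ‖(ρ * (x' - x) : ℂ)‖ ≤ K * (2 * Q) := by
      rw [norm_mul, Complex.norm_real, Real.norm_eq_abs]; gcongr; linarith
    linarith

theorem HasForm.exists_quadForm_negInv (h : HasForm ρ q r F) {U : Set (ℂ × ℂ)}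
    (hU : U ∈ 𝓝 (0 : ℂ × ℂ)) (hinj : ∀ᶠ ε in 𝓝 (0 : ℂ), Set.InjOn (F ε) U) :
    ∃ C δ, QuadForm ρ (-q) (-r) (negInv F U) C δ := by
  obtain ⟨C, δ, hQ⟩ := h.exists_quadForm
  obtain ⟨h1, h2⟩ := h.exists_inverse hU hinj
  have hC := hQ.nonneg
  set K := 1 + ‖q‖ + ‖r‖ + |ρ| + C with hK
  have hK0 : 0 < K := by positivity
  refine ⟨400 * K ^ 2, exists_quadForm_of_eventually (by positivity) ?_⟩
  have hneg : Tendsto (fun t : ℂ × ℂ × ℂ => (t.1, -t.2)) (𝓝 0) (𝓝 0) := by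
    have : Continuous fun t : ℂ × ℂ × ℂ => (t.1, -t.2) := by fun_prop
    simpa [← Prod.zero_eq_mk] using this.tendsto 0
  have g1 := h1.comp hneg
  have g3 : Tendsto (fun t : ℂ × ℂ × ℂ => ‖(invBranch (F t.1) U (-t.2)).1‖ +
      ‖(invBranch (F t.1) U (-t.2)).2‖ + ‖t.1‖) (𝓝 0) (𝓝 0) := by
    have a1 := ((continuous_fst.norm.tendsto (0 : ℂ × ℂ)).comp g1).add
      ((continuous_snd.norm.tendsto (0 : ℂ × ℂ)).comp g1)
    have a2 := a1.add (continuous_fst.norm.tendsto (0 : ℂ × ℂ × ℂ))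
    simpa [Function.comp_def] using a2
  have hpos : 0 < min δ (1 / (100 * K)) := lt_min hQ.pos (by positivity)
  filter_upwards [hneg.eventually h2, g3.eventually_lt_const hpos] with t ⟨b1, _, _⟩ b2
  set x := (invBranch (F t.1) U (-t.2)).1 with hx
  set y := (invBranch (F t.1) U (-t.2)).2 with hy
  have hxy : invBranch (F t.1) U (-t.2) = (x, y) := rfl
  have hδ := b2.trans_le (min_le_left _ _)
  have hδ' := b2.trans_le (min_le_right _ _)
  have x0 := norm_nonneg x
  have y0 := norm_nonneg y
  have t0 := norm_nonneg t.1
  obtain ⟨a, b, e, ha, hb⟩ := hQ.form t.1 x y (by linarith) (by linarith) (by linarith)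
  rw [← hxy, b1] at e
  rw [lt_div_iff₀ (by positivity)] at hδ'
  obtain ⟨A, B, c1, c2, c3, c4⟩ := inverse_form (x' := -t.2.1) (y' := -t.2.2) (q := q) (r := r)
    (ρ := ρ) hK.symm hC hδ'.le (congrArg Prod.fst e) (congrArg Prod.snd e) ha hb
  simp only [neg_neg, norm_neg] at c1 c2 c3 c4
  refine ⟨A, B, ?_, c3, c4⟩
  rw [negInv, hxy, Prod.neg_mk, c1, c2]

/-! ### Outgoing coordinates as negated incoming coordinates -/

theorem wOut0_eq (q : ℂ) (p : ℂ × ℂ) : wOut0 q p = -wIn0 (-q) (-p) := by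
  rw [wOut0, wIn0, Prod.fst_neg, neg_neg, div_neg]; ring

theorem phiOut0_eq (q : ℂ) (F : ℂ → ℂ × ℂ → ℂ × ℂ) (U : Set (ℂ × ℂ)) (n : ℕ) (p : ℂ × ℂ) :
    phiOut0 q F U n p = -phiIn0 (-q) (negInv F U) n (-p) := by
  rw [phiOut0, phiIn0, wOut0_eq, invBranch_iterate F U 0 n p, neg_neg]; ring

/-- Changing the sign of `x` inverts the quotient, and `log(1/z) = -log z` requires `z` to avoid the
negative axis. -/
theorem u_neg {ε x : ℂ}
    (h : (Complex.I * ε - x) / (Complex.I * ε + x) ∈ Complex.slitPlane) : u ε (-x) = -u ε x := by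
  rw [u, u, sub_neg_eq_add, ← sub_eq_add_neg, ← inv_div (Complex.I * ε - x),
    Complex.log_inv _ (Complex.mem_slitPlane_iff_arg.mp h).1]
  ring

theorem phiOut_eq (q : ℂ) (F : ℂ → ℂ × ℂ → ℂ × ℂ) (U : Set (ℂ × ℂ)) (ε : ℂ) (n : ℕ) (p : ℂ × ℂ)
    (h : (Complex.I * ε - ((negInv F U ε)^[n] (-p)).1) /
      (Complex.I * ε + ((negInv F U ε)^[n] (-p)).1) ∈ Complex.slitPlane) :
    phiOut q F U ε n p = -phiIn (-q) (negInv F U) ε n (-p) := by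
  rw [phiOut, phiIn, invBranch_iterate F U ε n p, wOut, wIn, w, w, Prod.fst_neg, u_neg h,
    neg_sq]
  ring

theorem sector_subset {γ R s γ' R' s' : ℝ} (hγ : 0 < γ) (h1 : γ ≤ γ') (h2 : R ≤ R') (h3 : s ≤ s') :
    sector γ R s ⊆ sector γ' R' s' := by
  intro p hp
  have hre := sector_re_neg hγ hp
  obtain ⟨a1, a2, a3, a4⟩ := hp
  refine ⟨a1, a2.trans ?_, a3.trans h2, a4.trans (by gcongr)⟩
  nlinarith

theorem QuadForm.exists_tame (h : QuadForm ρ q r F C δ)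
    (hc : ∀ᶠ t : ℂ × ℂ × ℂ in 𝓝 0, ContinuousAt (fun t : ℂ × ℂ × ℂ => F t.1 t.2) t)
    {δ₁ : ℝ} (hδ₁ : 0 < δ₁) : ∃ C' δ', δ' ≤ δ₁ ∧ Tame ρ q r F C' δ' := by
  obtain ⟨C', δ', hS⟩ := h.exists_stepBound
  obtain ⟨δ₂, hδ₂, hc⟩ := exists_ball
    (P := fun ε p => ContinuousAt (fun t : ℂ × ℂ × ℂ => F t.1 t.2) (ε, p)) hc
  have hpos : 0 < min δ' (min δ₁ δ₂) := lt_min hS.pos (lt_min hδ₁ hδ₂)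
  refine ⟨C', min δ' (min δ₁ δ₂), (min_le_right _ _).trans (min_le_left _ _),
    hS.mono hpos (min_le_left _ _), fun p h1 h2 => hc 0 p (by simpa using hδ₂) ?_ ?_⟩
  · exact h1.trans_le ((min_le_right _ _).trans (min_le_right _ _))
  · exact h2.trans_le ((min_le_right _ _).trans (min_le_right _ _))

/-- The sequence at `F 0 p` is that of `p` shifted by one index, so `F 0 p` need not lie in the
sector. -/
theorem Tame.tendsto_fatouIn_map (hF : Tame ρ q r F C δ) (hρ : 1 < ρ) {p : ℂ × ℂ}
    (hp : p ∈ bigSector ρ C δ) : fatouIn q F (F 0 p) = fatouIn q F p + 1 := by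
  have h := (hF.tendsto_fatouIn hρ hp).comp (tendsto_add_atTop_nat 1)
  refine Tendsto.limUnder_eq ((h.add_const 1).congr fun n => ?_)
  simp only [Function.comp_apply, phiIn0, Function.iterate_succ_apply]
  push_cast
  ring

section Outgoing

variable {U : Set (ℂ × ℂ)}

theorem tendsto_fatouOut (hG : Tame ρ (-q) (-r) (negInv F U) C δ) (hρ : 1 < ρ) {p : ℂ × ℂ}
    (hp : -p ∈ bigSector ρ C δ) :
    Tendsto (fun n => phiOut0 q F U n p) atTop (𝓝 (fatouOut q F U p)) ∧
      fatouOut q F U p = -fatouIn (-q) (negInv F U) (-p) := by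
  have h := (hG.tendsto_fatouIn hρ hp).neg
  simp only [← phiOut0_eq] at h
  have e : fatouOut q F U p = -fatouIn (-q) (negInv F U) (-p) := h.limUnder_eq
  exact ⟨by rwa [e], e⟩

theorem mapsTo_neg (S : Set (ℂ × ℂ)) : Set.MapsTo (fun p => -p) (-S) S := fun _ hp => hp

theorem tendstoLocallyUniformlyOn_phiOut0 (hG : Tame ρ (-q) (-r) (negInv F U) C δ) (hρ : 1 < ρ) :
    TendstoLocallyUniformlyOn (phiOut0 q F U) (fatouOut q F U) atTop (-bigSector ρ C δ) := by
  have h := ((hG.tendstoLocallyUniformlyOn_phiIn0 hρ).comp _ (mapsTo_neg _)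
    continuous_neg.continuousOn).neg
  refine (h.congr fun n p _ => ?_).congr_right fun p hp => ?_
  · exact (phiOut0_eq q F U n p).symm
  · exact (tendsto_fatouOut hG hρ hp).2.symm

theorem tendsto_prod_neg (S : Set (ℂ × ℂ)) (p : ℂ × ℂ) :
    Tendsto (fun z : ℕ × (ℂ × ℂ) => (z.1, -z.2)) (atTop ×ˢ 𝓝[-S] p) (atTop ×ˢ 𝓝[S] (-p)) := by
  refine tendsto_fst.prodMk (Tendsto.comp ?_ tendsto_snd)
  exact continuous_neg.continuousWithinAt.tendsto_nhdsWithin (mapsTo_neg S)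

theorem tendstoLocallyUniformlyOn_phiOut (hG : Tame ρ (-q) (-r) (negInv F U) C δ) (hρ : 1 < ρ)
    {ε : ℕ → ℂ} {m : ℕ → ℕ} (hb : BoundedType ε m) :
    TendstoLocallyUniformlyOn (fun ν => phiOut q F U (ε ν) (m ν)) (fatouOut q F U) atTop
      (-bigSector ρ C δ) := by
  have h := ((hG.tendstoLocallyUniformlyOn_phiIn hρ hb).comp _ (mapsTo_neg _)
    continuous_neg.continuousOn).neg
  have h := h.congr_right (g := fatouOut q F U) fun p hp => (tendsto_fatouOut hG hρ hp).2.symm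
  rw [tendstoLocallyUniformlyOn_iff_forall_tendsto] at h ⊢
  intro p hp
  refine (h p hp).congr' ?_
  filter_upwards [(tendsto_prod_neg _ p).eventually (hG.eventually_small hρ hp hb)] with z hz
  rw [phiOut_eq q F U (ε z.1) (m z.1) z.2 hz.2]
  rfl

/-- The condition at index `j` is what makes the next inverse iterate genuine, so `j < m` suffices
for `m` backward steps. Compactness makes the local statements uniform on `K`. -/
theorem eventually_mem_image (hG : Tame ρ (-q) (-r) (negInv F U) C δ) (hρ : 1 < ρ)
    {ε : ℕ → ℂ} {m : ℕ → ℕ} (hb : BoundedType ε m) {K : Set (ℂ × ℂ)} (hK : IsCompact K)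
    (hKS : K ⊆ -bigSector ρ C δ)
    (himg : ∀ ε p, ‖ε‖ < δ → ‖p.1‖ < δ → ‖p.2‖ < δ → p ∈ F ε '' U) :
    ∀ᶠ ν in atTop, ∀ p ∈ K, ∀ j < m ν, (invBranch (F (ε ν)) U)^[j] p ∈ F (ε ν) '' U := by
  have hε : ∀ᶠ ν in atTop, ‖ε ν‖ < δ := by
    have := hb.2.1.norm
    rw [norm_zero] at this
    exact this.eventually_lt_const hG.pos
  refine hK.induction_on (p := fun s => ∀ᶠ ν in atTop, ∀ p ∈ s, ∀ j < m ν,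
    (invBranch (F (ε ν)) U)^[j] p ∈ F (ε ν) '' U) ?_ ?_ ?_ ?_
  · exact Eventually.of_forall fun ν p hp => absurd hp (Set.notMem_empty p)
  · exact fun s t hst h => h.mono fun ν hν p hp => hν p (hst hp)
  · intro s t hs ht
    filter_upwards [hs, ht] with ν h1 h2 p hp
    exact hp.elim (h1 p) (h2 p)
  · intro p hp
    have h := (tendsto_prod_neg _ p).eventually (hG.eventually_small hρ (hKS hp) hb)
    obtain ⟨P₁, h1, P₂, h2, h12⟩ := eventually_prod_iff.mp h
    refine ⟨{z | P₂ z}, nhdsWithin_mono _ hKS h2, ?_⟩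
    filter_upwards [h1, hε] with ν a1 a2 z hz j hj
    obtain ⟨b1, b2⟩ := (h12 a1 hz).1 j hj.le
    rw [invBranch_iterate]
    exact himg _ _ a2 (by simpa using b1) (by simpa using b2)

end Outgoing

end TangentFamily

/-! ### Main theorem -/

theorem mainTheorem2 (ρ : ℝ) (hρ : 1 < ρ) (q r : ℂ) (F : ℂ → ℂ × ℂ → ℂ × ℂ)
    (hF : TangentFamily.HasForm ρ q r F)
    (U : Set (ℂ × ℂ)) (hU : U ∈ 𝓝 (0 : ℂ × ℂ))
    (hinj : ∀ᶠ ε in 𝓝 (0 : ℂ), Set.InjOn (F ε) U) :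
    ∃ γ₀ > (0 : ℝ), ∃ R₀ > (0 : ℝ), ∃ s₀ > (0 : ℝ),
      ∀ γ R s : ℝ, 0 < γ → γ ≤ γ₀ → 0 < R → R ≤ R₀ → 0 < s → s ≤ s₀ →
        -- the incoming Fatou coordinate of `F₀` is well defined on the sector
        (TendstoLocallyUniformlyOn (TangentFamily.phiIn0 q F) (TangentFamily.fatouIn q F)
            atTop (TangentFamily.sector γ R s) ∧
          ∀ p ∈ TangentFamily.sector γ R s,
            TangentFamily.fatouIn q F (F 0 p) = TangentFamily.fatouIn q F p + 1) ∧
        -- the outgoing Fatou coordinate of `F₀` is well defined on the opposite sector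
        ((∀ p ∈ -TangentFamily.sector γ R s, ∀ j : ℕ,
            (TangentFamily.invBranch (F 0) U)^[j] p ∈ F 0 '' U) ∧
          TendstoLocallyUniformlyOn (TangentFamily.phiOut0 q F U)
            (TangentFamily.fatouOut q F U) atTop (-TangentFamily.sector γ R s) ∧
          ∀ p ∈ -TangentFamily.sector γ R s,
            TangentFamily.fatouOut q F U (F 0 p) = TangentFamily.fatouOut q F U p + 1) ∧
        ∀ (ε : ℕ → ℂ) (m : ℕ → ℕ), TangentFamily.BoundedType ε m →
          -- convergence of the incoming almost Fatou coordinates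
          TendstoLocallyUniformlyOn (fun ν => TangentFamily.phiIn q F (ε ν) (m ν))
            (TangentFamily.fatouIn q F) atTop (TangentFamily.sector γ R s) ∧
          -- the backward iterates involved are eventually defined on every compact set
          (∀ K ⊆ -TangentFamily.sector γ R s, IsCompact K →
            ∀ᶠ ν in atTop, ∀ p ∈ K, ∀ j < m ν,
              (TangentFamily.invBranch (F (ε ν)) U)^[j] p ∈ F (ε ν) '' U) ∧
          -- convergence of the outgoing almost Fatou coordinates
          TendstoLocallyUniformlyOn (fun ν => TangentFamily.phiOut q F U (ε ν) (m ν))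
            (TangentFamily.fatouOut q F U) atTop (-TangentFamily.sector γ R s) := by
  open TangentFamily in
  obtain ⟨C₁, δ₁, hQ⟩ := hF.exists_quadForm
  have hcF : ∀ᶠ t : ℂ × ℂ × ℂ in 𝓝 0, ContinuousAt (fun t : ℂ × ℂ × ℂ => F t.1 t.2) t :=
    hF.analyticAt.1.eventually_analyticAt.mono fun t ht => ht.continuousAt
  obtain ⟨C, δ, -, hT⟩ := hQ.exists_tame hcF one_pos
  obtain ⟨C₂, δ₂, hQG⟩ := hF.exists_quadForm_negInv hU hinj
  obtain ⟨-, hinv⟩ := hF.exists_inverse hU hinj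
  have hneg : Tendsto (fun t : ℂ × ℂ × ℂ => (t.1, -t.2)) (𝓝 0) (𝓝 0) := by
    have : Continuous fun t : ℂ × ℂ × ℂ => (t.1, -t.2) := by fun_prop
    simpa [← Prod.zero_eq_mk] using this.tendsto 0
  have hcG : ∀ᶠ t : ℂ × ℂ × ℂ in 𝓝 0,
      ContinuousAt (fun t : ℂ × ℂ × ℂ => negInv F U t.1 t.2) t := by
    filter_upwards [hneg.eventually hinv] with t ht
    have h1 : ContinuousAt (fun t : ℂ × ℂ × ℂ => (t.1, -t.2)) t := by fun_prop
    exact (ContinuousAt.comp (f := fun t : ℂ × ℂ × ℂ => (t.1, -t.2)) ht.2.2 h1).neg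
  -- Points near the origin lie both in the image of `U`, so that the inverse is defined, and in `U`
  -- itself, so that the inverse undoes `F 0` in the outgoing functional equation.
  obtain ⟨η, hη, hball⟩ := exists_ball (P := fun ε p => p ∈ F ε '' U ∧ p ∈ U)
    (hinv.and (((continuous_snd.tendsto (0 : ℂ × ℂ × ℂ)).eventually hU)) |>.mono
      fun t ht => ⟨ht.1.2.1, ht.2⟩)
  obtain ⟨C', δ', hδ', hG⟩ := hQG.exists_tame hcG hη
  have himg : ∀ ε p, ‖ε‖ < δ' → ‖p.1‖ < δ' → ‖p.2‖ < δ' → p ∈ F ε '' U := fun ε p h1 h2 h3 =>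
    (hball ε p (h1.trans_le hδ') (h2.trans_le hδ') (h3.trans_le hδ')).1
  have pos : ∀ {C δ : ℝ}, 0 < δ → 0 < radiusBound δ ∧ 0 < slopeBound ρ C := fun h => by
    have h1 := one_le_orbitTau h
    exact ⟨by rw [radiusBound]; positivity, half_pos orbitSigma_pos⟩
  refine ⟨openingBound, by norm_num [openingBound], min (radiusBound δ) (radiusBound δ'),
    lt_min (pos (C := C) hT.pos).1 (pos (C := C) hG.pos).1, min (slopeBound ρ C) (slopeBound ρ C'),
    lt_min (pos hT.pos).2 (pos hG.pos).2, ?_⟩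
  intro γ R s hγ hγ' _ hR _ hs
  have s1 : sector γ R s ⊆ bigSector ρ C δ :=
    sector_subset hγ hγ' (hR.trans (min_le_left _ _)) (hs.trans (min_le_left _ _))
  have s2 : sector γ R s ⊆ bigSector ρ C' δ' :=
    sector_subset hγ hγ' (hR.trans (min_le_right _ _)) (hs.trans (min_le_right _ _))
  have s3 : -sector γ R s ⊆ -bigSector ρ C' δ' := fun p hp => s2 hp
  have hmem : ∀ p ∈ -sector γ R s, ∀ j, (invBranch (F 0) U)^[j] p ∈ F 0 '' U ∧
      (invBranch (F 0) U)^[j] p ∈ U := by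
    intro p hp j
    obtain ⟨h1, h2⟩ := hG.small_zero hρ.le (s3 hp) j
    rw [invBranch_iterate]
    refine hball _ _ (by simpa using hη) ?_ ?_
    · simpa using h1.trans_le hδ'
    · simpa using h2.trans_le hδ'
  refine ⟨⟨(hT.tendstoLocallyUniformlyOn_phiIn0 hρ).mono s1,
      fun p hp => hT.tendsto_fatouIn_map hρ (s1 hp)⟩,
    ⟨fun p hp j => (hmem p hp j).1, (tendstoLocallyUniformlyOn_phiOut0 hG hρ).mono s3, ?_⟩,
    fun ε m hb => ⟨(hT.tendstoLocallyUniformlyOn_phiIn hρ hb).mono s1,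
      fun K hK hKc => eventually_mem_image hG hρ hb hKc (hK.trans s3) himg,
      (tendstoLocallyUniformlyOn_phiOut hG hρ hb).mono s3⟩⟩
  intro p hp
  have h := (tendsto_fatouOut hG hρ (s3 hp)).1
  have hpU : p ∈ U := (hmem p hp 0).2
  -- By this identity the outgoing sequence at `F 0 p`, read from index 1, is the sequence at `p`
  -- plus 1.
  have hinv0 : invBranch (F 0) U (F 0 p) = p := hinj.self_of_nhds.leftInvOn_invFunOn hpU
  refine Tendsto.limUnder_eq ?_
  rw [← tendsto_add_atTop_iff_nat 1]
  refine (h.add_const 1).congr fun n => ?_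
  rw [phiOut0, phiOut0, Function.iterate_succ_apply, hinv0]
  push_cast
  ring
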